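/- Let $i\colon G\to H$ be a crossed module of (finite-dimensional, real) Lie groups: $i$ is a Lie group morphism and $H$ acts smoothly on $G$ from the right by automorphisms $g\mapsto g^h$ with $i(g^h)=h^{-1}i(g)h$ and $x^{i(y)}=y^{-1}xy$. Let $N_\bullet$ be the geometric nerve of the associated Lie $2$-group $G\rtimes H\rightrightarrows H\rightrightarrows\{*\}$, where $(g,h)$ is a $2$-arrow from $h$ to $h\,i(g)$, the vertical composition is $(g,h)\star(g',h\,i(g))=(gg',h)$ and the horizontal composition is $(g,h)*(g',h')=(g^{h'}g',hh')$. Thus a $q$-simplex with vertices $0,\dots,q$ consists of elements $f_{ab}\in H$ ($a<b$) and $g_{abc}\in G$ ($a<b<c$) with $f_{ab}f_{bc}\,i(g_{abc})=f_{ac}$ and $g_{abc}^{f_{cd}}\,g_{acd}=g_{bcd}\,g_{abd}$; the $f_{0b}$ and $g_{0bc}$ are smooth coordinates $N_q\cong H^q\times G^{q(q-1)/2}$, and the face map $d_i$ forgets the vertex $i$. In particular $N_2\cong G\times H\times H$ via $(g_{012},\,f_{01}f_{12},\,f_{12})$. Let $\Omega^n_{\rm tot}=\bigoplus_{p+q=n}\Omega^p(N_q)$,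 with differential $d_{\rm dR}+\partial$, where $\partial=(-1)^p\sum_{i=0}^{q+1}(-1)^i d_i^*$ on $\Omega^p(N_q)$; this is a cochain complex. Let $\mathfrak g$ be the Lie algebra of $G$, and let $(\mathfrak g^*)^{\mathfrak g,H}$ be the space of linear forms on $\mathfrak g$ invariant under the coadjoint action of $\mathfrak g$ and under the action induced by that of $H$ on $G$. For $\xi\in(\mathfrak g^*)^{\mathfrak g,H}$ let $\xi^L$ be the left-invariant $1$-form on $G$ with value $\xi$ at the identity, and let $I(\xi)$ be the pullback of $\xi^L$ along the projection $N_2\cong G\times H\times H\to G$. Then $\xi\mapsto I(\xi)$ is a linear map from $(\mathfrak g^*)^{\mathfrak g,H}$ to $\Omega^1(N_2)\subset\Omega^3_{\rm tot}$, and $d_{\rm dR}I(\xi)=0$. Suppose moreover that * every group homomorphism $G\to\mathbb R$ that is trivial on the identity component of $G$ is trivial (for example, $G$ has finitely many connected components), or * $i$ is a submersion, i.e. $d i\colon\mathfrak g\to\mathfrak h$ is surjective (for example, $H$ is discrete). Then $(d_{\rm dR}+\partial)I(\xi)=0$ for every $\xi\in(\mathfrak g^*)^{\mathfrak g,H}$;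 equivalently, $I$ is a map of cochain complexes from $(\mathfrak g^*)^{\mathfrak g,H}[3]$ (concentrated in degree $3$, with zero differential) to $(\Omega^\bullet_{\rm tot},d_{\rm dR}+\partial)$. -/

import Mathlib

open scoped Manifold ContDiff Topology

universe u

noncomputable section

namespace LieTwo

section Forms

variable {E : Type*} [NormedAddCommGroup E] [NormedSpace ℝ E] {H : Type*} [TopologicalSpace H]
  {I : ModelWithCorners ℝ E H} {M : Type*} [TopologicalSpace M] [ChartedSpace H M]
  {E' : Type*} [NormedAddCommGroup E'] [NormedSpace ℝ E'] {H' : Type*} [TopologicalSpace H']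
  {I' : ModelWithCorners ℝ E' H'} {M' : Type*} [TopologicalSpace M'] [ChartedSpace H' M']
  {p : ℕ}

/-- Left inverse of the inclusion of alternating maps into multilinear maps. -/
def altProj (E : Type*) [NormedAddCommGroup E] [NormedSpace ℝ E] (p : ℕ) :
    ContinuousMultilinearMap ℝ (fun _ : Fin p => E) ℝ →L[ℝ] E [⋀^Fin p]→L[ℝ] ℝ :=
  LinearMap.mkContinuous
    { toFun := fun f => ((p.factorial : ℝ)⁻¹) • f.alternatization
      map_add' := fun f g => by simp
      map_smul' := fun c f => by
        ext v
        simp [ContinuousMultilinearMap.alternatization_apply_apply, Finset.mul_sum,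
          mul_left_comm, Units.smul_def] } 1 (by
    intro f
    rw [one_mul]
    refine ContinuousAlternatingMap.opNorm_le_bound _ (norm_nonneg f) fun v => ?_
    have hp : (0 : ℝ) < p.factorial := by exact_mod_cast p.factorial_pos
    have h : ‖f.alternatization v‖ ≤ p.factorial * (‖f‖ * ∏ i, ‖v i‖) := by
      rw [ContinuousMultilinearMap.alternatization_apply_apply]
      refine (norm_sum_le _ _).trans ?_
      refine (Finset.sum_le_card_nsmul _ _ (‖f‖ * ∏ i, ‖v i‖) fun σ _ => ?_).trans ?_
      · have h1 : ‖Equiv.Perm.sign σ • f (v ∘ σ)‖ = ‖f (v ∘ σ)‖ := by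
          rcases Int.units_eq_one_or (Equiv.Perm.sign σ) with h | h <;> simp [h]
        rw [h1]
        refine (f.le_opNorm _).trans_eq ?_
        congr 1
        exact Equiv.prod_comp σ (fun i => ‖v i‖)
      · simp [Fintype.card_perm]
    change ‖(p.factorial : ℝ)⁻¹ • f.alternatization v‖ ≤ _
    rw [norm_smul, norm_inv, Real.norm_of_nonneg hp.le, inv_mul_le_iff₀ hp]
    exact h)

theorem altProj_apply (f : E [⋀^Fin p]→L[ℝ] ℝ) :
    altProj E p f.toContinuousMultilinearMap = f := by
  ext v
  have hp : (p.factorial : ℝ) ≠ 0 := by exact_mod_cast p.factorial_ne_zero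
  have h : ∀ σ : Equiv.Perm (Fin p), Equiv.Perm.sign σ • f (v ∘ σ) = f v := by
    intro σ
    have := f.toAlternatingMap.map_perm v σ
    have h2 : f (v ∘ σ) = Equiv.Perm.sign σ • f v := this
    rw [h2, smul_smul]
    simp
  change (p.factorial : ℝ)⁻¹ • (f.toContinuousMultilinearMap.alternatization v) = _
  rw [ContinuousMultilinearMap.alternatization_apply_apply]
  change (p.factorial : ℝ)⁻¹ • (∑ σ : Equiv.Perm (Fin p), Equiv.Perm.sign σ • f (v ∘ σ)) = _
  rw [Finset.sum_congr rfl fun σ _ => h σ]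
  simp [Fintype.card_perm, hp]

theorem minSmoothness_le_infty : minSmoothness ℝ 2 ≤ (∞ : ℕ∞ω) := by
  simp only [minSmoothness_of_isRCLikeNormedField]
  exact WithTop.coe_le_coe.2 (le_top : (2 : ℕ∞) ≤ ⊤)

theorem contDiffAt_pullback {α : E' → E' [⋀^Fin p]→L[ℝ] ℝ} {ψ : E → E'} {y : E}
    (hα : ContDiffAt ℝ ∞ α (ψ y)) (hψ : ContDiffAt ℝ ∞ ψ y) :
    ContDiffAt ℝ ∞ (fun z => (α (ψ z)).compContinuousLinearMap (fderiv ℝ ψ z)) y := by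
  have h1 : ContDiffAt ℝ ∞ (fun z => α (ψ z)) y := hα.comp y hψ
  have h2 : ContDiffAt ℝ ∞ (fun z => fderiv ℝ ψ z) y := hψ.fderiv_right (by simp)
  have h3 : ContDiffAt ℝ ∞ (fun z =>
      (α (ψ z)).toContinuousMultilinearMap) y :=
    (ContinuousAlternatingMap.toContinuousMultilinearMapLI (𝕜 := ℝ) (E := E') (F := ℝ)
      (ι := Fin p)).contDiff.contDiffAt.comp y h1
  have h4 : ContDiffAt ℝ ∞ (fun z =>
      ContinuousMultilinearMap.compContinuousLinearMapContinuousMultilinear ℝ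
        (fun _ : Fin p => E) (fun _ => E') ℝ (fun _ => fderiv ℝ ψ z)) y :=
    ContDiffAt.comp (f := fun z (_ : Fin p) => fderiv ℝ ψ z) y
      (ContinuousMultilinearMap.contDiff (𝕜 := ℝ) (E := fun _ : Fin p => E →L[ℝ] E')
        (F := ContinuousMultilinearMap ℝ (fun _ : Fin p => E') ℝ →L[ℝ]
          ContinuousMultilinearMap ℝ (fun _ : Fin p => E) ℝ)
        (ContinuousMultilinearMap.compContinuousLinearMapContinuousMultilinear ℝ
          (fun _ : Fin p => E) (fun _ => E') ℝ)).contDiffAt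
      (contDiffAt_pi.2 fun _ => h2)
  have h5 := (altProj E p).contDiff.contDiffAt.comp y (h4.clm_apply h3)
  refine h5.congr_of_eventuallyEq (Filter.Eventually.of_forall fun z => ?_)
  exact (altProj_apply ((α (ψ z)).compContinuousLinearMap (fderiv ℝ ψ z))).symm

variable (I) in
/-- A field of alternating `p`-forms on the tangent spaces of `M`, without any regularity. -/
abbrev RawForm (M : Type*) [TopologicalSpace M] [ChartedSpace H M] (p : ℕ) :=
  ∀ x : M, TangentSpace I x [⋀^Fin p]→L[ℝ] ℝ

/-- The pullback `φ^* α` of a field of alternating forms. -/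
def rawPullback (φ : M → M') (α : RawForm I' M' p) : RawForm I M p := fun y =>
  (α (φ y)).compContinuousLinearMap (mfderiv I I' φ y)

/-- The pullback of a field of alternating forms to a normed space. -/
def vecPullback (φ : E → M') (α : RawForm I' M' p) : E → E [⋀^Fin p]→L[ℝ] ℝ :=
  rawPullback (I := 𝓘(ℝ, E)) φ α

/-- The expression of `α` in the preferred chart at `x₀`. -/
def localRep (α : RawForm I M p) (x₀ : M) : E → E [⋀^Fin p]→L[ℝ] ℝ :=
  vecPullback (extChartAt I x₀).symm α

theorem rawPullback_comp {E₂ : Type*} [NormedAddCommGroup E₂] [NormedSpace ℝ E₂] {H₂ : Type*}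
    [TopologicalSpace H₂] {I₂ : ModelWithCorners ℝ E₂ H₂} {M₂ : Type*} [TopologicalSpace M₂]
    [ChartedSpace H₂ M₂] {φ : M → M'} {ψ : M' → M₂} (α : RawForm I₂ M₂ p) {y : M}
    (hψ : MDifferentiableAt I' I₂ ψ (φ y)) (hφ : MDifferentiableAt I I' φ y) :
    rawPullback (I := I) (ψ ∘ φ) α y =
      rawPullback (I := I) (I' := I') φ (rawPullback (I := I') ψ α) y := by
  unfold rawPullback
  rw [mfderiv_comp y hψ hφ]
  rfl

theorem rawPullback_congr {φ φ' : M → M'} (α : RawForm I' M' p) {y : M}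
    (h : φ =ᶠ[𝓝 y] φ') :
    rawPullback (I := I) φ α y = rawPullback (I := I) φ' α y := by
  have h0 : ∀ a b : M', a = b → ∀ w : Fin p → E', (α a : E' [⋀^Fin p]→L[ℝ] ℝ) w =
      (α b : E' [⋀^Fin p]→L[ℝ] ℝ) w := by
    rintro a b rfl w
    rfl
  unfold rawPullback
  rw [h.mfderiv_eq]
  ext v
  exact h0 _ _ h.eq_of_nhds _

/-- Smoothness of a field of forms: its expression in every preferred chart is smooth. -/
def IsSmoothForm (α : RawForm I M p) : Prop :=
  ∀ x₀ : M, ContDiffOn ℝ ∞ (localRep α x₀) (extChartAt I x₀).target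

/-- The exterior derivative, computed at `x` in the preferred chart at `x`. -/
def rawExtDeriv (α : RawForm I M p) : RawForm I M (p + 1) := fun x =>
  (extDeriv (localRep α x) (extChartAt I x x)).compContinuousLinearMap
    (mfderiv I 𝓘(ℝ, E) (extChartAt I x) x)

theorem localRep_add (α β : RawForm I M p) (x₀ : M) :
    localRep (α + β) x₀ = localRep α x₀ + localRep β x₀ := rfl

theorem localRep_smul (c : ℝ) (α : RawForm I M p) (x₀ : M) :
    localRep (c • α) x₀ = c • localRep α x₀ := rfl

variable (I M p) in
/-- The space `Ω^p(M)` of smooth differential `p`-forms. -/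
def DForm : Submodule ℝ (RawForm I M p) where
  carrier := {α | IsSmoothForm α}
  zero_mem' := fun _ => contDiffOn_const (c := (0 : E [⋀^Fin p]→L[ℝ] ℝ))
  add_mem' := fun hα hβ x₀ => (hα x₀).add (hβ x₀)
  smul_mem' := fun c _ hα x₀ => (hα x₀).const_smul c

theorem DForm.smooth (α : DForm I M p) : IsSmoothForm α.1 := α.2

section

variable [I.Boundaryless] [I'.Boundaryless] [IsManifold I ∞ M] [IsManifold I' ∞ M']

theorem contMDiffAt_symm {x₀ : M} {y : E} (hy : y ∈ (extChartAt I x₀).target) :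
    ContMDiffAt 𝓘(ℝ, E) I ∞ (extChartAt I x₀).symm y :=
  (contMDiffOn_extChartAt_symm (n := ∞) x₀).contMDiffAt
    ((isOpen_extChartAt_target x₀).mem_nhds hy)

/-- A map from a vector space to a manifold, written locally through a chart of the target. -/
theorem rawPullback_local {α : RawForm I' M' p} {φ : E → M'} {y : E}
    (hφ : ContMDiffAt 𝓘(ℝ, E) I' ∞ φ y) :
    ContDiffAt ℝ ∞ (extChartAt I' (φ y) ∘ φ) y ∧
    vecPullback φ α =ᶠ[𝓝 y] fun z =>
      (localRep α (φ y) ((extChartAt I' (φ y) ∘ φ) z)).compContinuousLinearMap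
        (fderiv ℝ (extChartAt I' (φ y) ∘ φ) z) := by
  have hc : ContMDiffAt I' 𝓘(ℝ, E') ∞ (extChartAt I' (φ y)) (φ y) := contMDiffAt_extChartAt
  have hs : ContMDiffAt 𝓘(ℝ, E) 𝓘(ℝ, E') ∞ (extChartAt I' (φ y) ∘ φ) y := hc.comp y hφ
  refine ⟨contMDiffAt_iff_contDiffAt.1 hs, ?_⟩
  have h1 : ∀ᶠ z in 𝓝 y, φ z ∈ (extChartAt I' (φ y)).source :=
    hφ.continuousAt.eventually (extChartAt_source_mem_nhds (φ y))
  have h2 : ∀ᶠ z in 𝓝 y, ContMDiffAt 𝓘(ℝ, E) 𝓘(ℝ, E') 1 (extChartAt I' (φ y) ∘ φ) z :=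
    (contMDiffAt_iff_contMDiffAt_nhds (by simp)).1
      (hs.of_le (by exact_mod_cast (le_top : (1 : ℕ∞) ≤ ⊤)))
  filter_upwards [h1.eventually_nhds, h2] with z hz hz2
  have hz1 := hz.self_of_nhds
  have e : φ =ᶠ[𝓝 z] (extChartAt I' (φ y)).symm ∘ (extChartAt I' (φ y) ∘ φ) := by
    filter_upwards [hz] with w hw
    exact ((extChartAt I' (φ y)).left_inv hw).symm
  have hsymm : MDifferentiableAt 𝓘(ℝ, E') I' (extChartAt I' (φ y)).symm
      ((extChartAt I' (φ y) ∘ φ) z) :=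
    (contMDiffAt_symm ((extChartAt I' (φ y)).map_source hz1)).mdifferentiableAt (by simp)
  unfold vecPullback
  rw [rawPullback_congr α e, rawPullback_comp α hsymm (hz2.mdifferentiableAt (by simp))]
  simp only [localRep, vecPullback, rawPullback, mfderiv_eq_fderiv]
  rfl

theorem IsSmoothForm.contDiffAt_vecPullback {α : RawForm I' M' p} (hα : IsSmoothForm α)
    {φ : E → M'} {y : E} (hφ : ContMDiffAt 𝓘(ℝ, E) I' ∞ φ y) :
    ContDiffAt ℝ ∞ (vecPullback φ α) y := by
  obtain ⟨h1, h2⟩ := rawPullback_local (α := α) hφ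
  refine (contDiffAt_pullback ?_ h1).congr_of_eventuallyEq h2
  exact (hα (φ y)).contDiffAt ((isOpen_extChartAt_target (φ y)).mem_nhds (mem_extChartAt_target _))

/-- The exterior derivative commutes with pullback to a vector space; in particular it can be
computed in any chart. -/
theorem IsSmoothForm.extDeriv_vecPullback {α : RawForm I' M' p} (hα : IsSmoothForm α)
    {φ : E → M'} {y : E} (hφ : ContMDiffAt 𝓘(ℝ, E) I' ∞ φ y) :
    extDeriv (vecPullback φ α) y =
      vecPullback φ (rawExtDeriv α) y := by
  obtain ⟨h1, h2⟩ := rawPullback_local (α := α) hφ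
  have h3 : ContDiffAt ℝ ∞ (localRep α (φ y)) ((extChartAt I' (φ y) ∘ φ) y) :=
    (hα (φ y)).contDiffAt ((isOpen_extChartAt_target (φ y)).mem_nhds (mem_extChartAt_target _))
  rw [Filter.EventuallyEq.extDeriv_eq h2,
    extDeriv_pullback (h3.differentiableAt (by simp)) h1 minSmoothness_le_infty]
  have hc : ContMDiffAt I' 𝓘(ℝ, E') ∞ (extChartAt I' (φ y)) (φ y) := contMDiffAt_extChartAt
  have h4 : fderiv ℝ (extChartAt I' (φ y) ∘ φ) y =
      (mfderiv I' 𝓘(ℝ, E') (extChartAt I' (φ y)) (φ y)).comp (mfderiv 𝓘(ℝ, E) I' φ y) := by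
    rw [← mfderiv_eq_fderiv]
    exact mfderiv_comp y (hc.mdifferentiableAt (by simp)) (hφ.mdifferentiableAt (by simp))
  rw [h4]
  rfl

theorem IsSmoothForm.localRep_rawExtDeriv {α : RawForm I M p} (hα : IsSmoothForm α) (x₀ : M)
    {y : E} (hy : y ∈ (extChartAt I x₀).target) :
    localRep (rawExtDeriv α) x₀ y = extDeriv (localRep α x₀) y :=
  (hα.extDeriv_vecPullback (contMDiffAt_symm hy)).symm

theorem contDiffAt_extDeriv {β : E → E [⋀^Fin p]→L[ℝ] ℝ} {y : E} (h : ContDiffAt ℝ ∞ β y) :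
    ContDiffAt ℝ ∞ (extDeriv β) y :=
  (ContinuousAlternatingMap.alternatizeUncurryFinCLM ℝ E ℝ).contDiff.contDiffAt.comp y
    (h.fderiv_right (by simp))

theorem IsSmoothForm.d {α : RawForm I M p} (hα : IsSmoothForm α) :
    IsSmoothForm (rawExtDeriv α) := by
  intro x₀ y hy
  have h : ContDiffAt ℝ ∞ (extDeriv (localRep α x₀)) y :=
    contDiffAt_extDeriv (hα.contDiffAt_vecPullback (contMDiffAt_symm hy))
  refine (h.congr_of_eventuallyEq ?_).contDiffWithinAt
  filter_upwards [(isOpen_extChartAt_target (I := I) x₀).mem_nhds hy] with z hz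
  exact hα.localRep_rawExtDeriv x₀ hz

theorem IsSmoothForm.d_d {α : RawForm I M p} (hα : IsSmoothForm α) :
    rawExtDeriv (rawExtDeriv α) = 0 := by
  funext x
  have hx : extChartAt I x x ∈ (extChartAt I x).target := mem_extChartAt_target x
  have h : localRep (rawExtDeriv α) x =ᶠ[𝓝 (extChartAt I x x)]
      extDeriv (localRep α x) := by
    filter_upwards [(isOpen_extChartAt_target (I := I) x).mem_nhds hx] with z hz
    exact hα.localRep_rawExtDeriv x hz
  have h0 : extDeriv (localRep (rawExtDeriv α) x) (extChartAt I x x) = 0 := by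
    rw [Filter.EventuallyEq.extDeriv_eq h]
    exact extDeriv_extDeriv_apply (hα.contDiffAt_vecPullback (contMDiffAt_symm hx))
      minSmoothness_le_infty
  unfold rawExtDeriv at h0 ⊢
  rw [h0]
  rfl

theorem localRep_rawPullback {f : M → M'} (hf : ContMDiff I I' ∞ f) (α : RawForm I' M' p)
    (x₀ : M) {y : E} (hy : y ∈ (extChartAt I x₀).target) :
    localRep (rawPullback (I := I) f α) x₀ y =
      vecPullback (f ∘ (extChartAt I x₀).symm) α y :=
  (rawPullback_comp α ((hf _).mdifferentiableAt (by simp))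
    ((contMDiffAt_symm hy).mdifferentiableAt (by simp))).symm

theorem IsSmoothForm.pullback {f : M → M'} (hf : ContMDiff I I' ∞ f) {α : RawForm I' M' p}
    (hα : IsSmoothForm α) : IsSmoothForm (rawPullback (I := I) f α) := by
  intro x₀ y hy
  refine ((hα.contDiffAt_vecPullback (φ := f ∘ (extChartAt I x₀).symm)
    ((hf _).comp y (contMDiffAt_symm hy))).congr_of_eventuallyEq ?_).contDiffWithinAt
  filter_upwards [(isOpen_extChartAt_target (I := I) x₀).mem_nhds hy] with z hz
  exact localRep_rawPullback hf α x₀ hz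

theorem IsSmoothForm.d_pullback {f : M → M'} (hf : ContMDiff I I' ∞ f)
    {α : RawForm I' M' p} (hα : IsSmoothForm α) :
    rawExtDeriv (rawPullback (I := I) f α) =
      rawPullback (I := I) f (rawExtDeriv α) := by
  funext x
  have hx : extChartAt I x x ∈ (extChartAt I x).target := mem_extChartAt_target x
  have h : localRep (rawPullback (I := I) f α) x =ᶠ[𝓝 (extChartAt I x x)]
      vecPullback (f ∘ (extChartAt I x).symm) α := by
    filter_upwards [(isOpen_extChartAt_target (I := I) x).mem_nhds hx] with z hz
    exact localRep_rawPullback hf α x hz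
  have hs := contMDiffAt_symm hx
  have hfs : ContMDiffAt 𝓘(ℝ, E) I' ∞ (f ∘ (extChartAt I x).symm) (extChartAt I x x) :=
    (hf _).comp _ hs
  have hc : ContMDiffAt I 𝓘(ℝ, E) ∞ (extChartAt I x) x := contMDiffAt_extChartAt
  change (extDeriv (localRep (rawPullback (I := I) f α) x)
    (extChartAt I x x)).compContinuousLinearMap (mfderiv I 𝓘(ℝ, E) (extChartAt I x) x) = _
  rw [Filter.EventuallyEq.extDeriv_eq h, hα.extDeriv_vecPullback hfs]
  have e : f =ᶠ[𝓝 x] (f ∘ (extChartAt I x).symm) ∘ extChartAt I x := by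
    filter_upwards [extChartAt_source_mem_nhds (I := I) x] with z hz
    exact congrArg f ((extChartAt I x).left_inv hz).symm
  rw [rawPullback_congr _ e, rawPullback_comp _ (hfs.mdifferentiableAt (by simp))
    (hc.mdifferentiableAt (by simp))]
  rfl

theorem IsSmoothForm.differentiableAt {α : RawForm I M p} (hα : IsSmoothForm α) (x : M) :
    DifferentiableAt ℝ (localRep α x) (extChartAt I x x) :=
  (hα.contDiffAt_vecPullback (contMDiffAt_symm (mem_extChartAt_target x))).differentiableAt
    (by simp)

/-- The de Rham differential `d : Ω^p(M) → Ω^{p+1}(M)`. -/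
def dR : DForm I M p →ₗ[ℝ] DForm I M (p + 1) where
  toFun α := ⟨rawExtDeriv α.1, (DForm.smooth α).d⟩
  map_add' := by
    intro α β
    apply Subtype.ext
    funext x
    simp only [rawExtDeriv, Submodule.coe_add, localRep_add, Pi.add_apply]
    rw [extDeriv_add ((DForm.smooth α).differentiableAt x) ((DForm.smooth β).differentiableAt x)]
    rfl
  map_smul' := by
    intro c α
    apply Subtype.ext
    funext x
    simp only [rawExtDeriv, Submodule.coe_smul, localRep_smul, Pi.smul_apply]
    rw [extDeriv_smul c]
    rfl

/-- The pullback `f^* : Ω^p(M') → Ω^p(M)` along a smooth map `f : M → M'`. -/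
def pullback (f : C^∞⟮I, M; I', M'⟯) : DForm I' M' p →ₗ[ℝ] DForm I M p where
  toFun α := ⟨rawPullback f α.1, (DForm.smooth α).pullback f.contMDiff⟩
  map_add' _ _ := rfl
  map_smul' _ _ := rfl

theorem dR_dR (α : DForm I M p) : dR (dR α) = 0 := Subtype.ext (DForm.smooth α).d_d

theorem dR_pullback (f : C^∞⟮I, M; I', M'⟯) (α : DForm I' M' p) :
    dR (pullback f α) = pullback f (dR α) := Subtype.ext ((DForm.smooth α).d_pullback f.contMDiff)

theorem pullback_comp {E₂ : Type*} [NormedAddCommGroup E₂] [NormedSpace ℝ E₂] {H₂ : Type*}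
    [TopologicalSpace H₂] {I₂ : ModelWithCorners ℝ E₂ H₂} [I₂.Boundaryless] {M₂ : Type*}
    [TopologicalSpace M₂] [ChartedSpace H₂ M₂] [IsManifold I₂ ∞ M₂]
    (g : C^∞⟮I', M'; I₂, M₂⟯) (f : C^∞⟮I, M; I', M'⟯) (α : DForm I₂ M₂ p) :
    pullback f (pullback g α) = pullback (g.comp f) α :=
  Subtype.ext (funext fun _ => (rawPullback_comp α.1 (g.contMDiff.mdifferentiableAt (by simp))
    (f.contMDiff.mdifferentiableAt (by simp))).symm)

end

end Forms

section Pi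

variable {ι : Type*} [Fintype ι] {E : ι → Type*} [∀ i, NormedAddCommGroup (E i)]
  [∀ i, NormedSpace ℝ (E i)] {H : ι → Type*} [∀ i, TopologicalSpace (H i)]
  {I : ∀ i, ModelWithCorners ℝ (E i) (H i)} {M : ι → Type*} [∀ i, TopologicalSpace (M i)]
  [∀ i, ChartedSpace (H i) (M i)]

instance boundaryless_pi [∀ i, (I i).Boundaryless] : (ModelWithCorners.pi I).Boundaryless where
  range_eq_univ := by
    refine Set.eq_univ_of_forall fun y => ?_
    refine ⟨fun i => (I i).symm (y i), funext fun i => ?_⟩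
    exact (I i).right_inv (by rw [(I i).range_eq_univ]; trivial)

instance isManifold_pi [∀ i, IsManifold (I i) ∞ (M i)] [∀ i, (I i).Boundaryless] :
    IsManifold (ModelWithCorners.pi I) ∞ (∀ i, M i) := by
  refine isManifold_of_contDiffOn _ _ _ ?_
  rintro _ _ ⟨e, he, rfl⟩ ⟨e', he', rfl⟩
  refine contDiffOn_pi.2 fun i => ?_
  have h := (contDiffGroupoid ∞ (I i)).compatible (he i trivial) (he' i trivial)
  rw [contDiffGroupoid, mem_groupoid_of_pregroupoid] at h
  have h1 : ContDiffOn ℝ ∞ ((I i) ∘ ((e i).symm.trans (e' i)) ∘ (I i).symm)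
    ((I i).symm ⁻¹' ((e i).symm.trans (e' i)).source ∩ Set.range (I i)) := h.1
  refine h1.comp (ContinuousLinearMap.proj (R := ℝ) (φ := E) i).contDiff.contDiffOn ?_
  rintro y ⟨hy, -⟩
  refine ⟨⟨hy.1 i trivial, hy.2 i trivial⟩, ?_⟩
  rw [(I i).range_eq_univ]
  trivial

theorem contMDiff_pi {E' : Type*} [NormedAddCommGroup E'] [NormedSpace ℝ E'] {H' : Type*}
    [TopologicalSpace H'] {I' : ModelWithCorners ℝ E' H'} {M' : Type*} [TopologicalSpace M']
    [ChartedSpace H' M'] {f : M' → ∀ i, M i}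
    (h : ∀ i, ContMDiff I' (I i) ∞ fun x => f x i) :
    ContMDiff I' (ModelWithCorners.pi I) ∞ f := by
  intro x
  rw [contMDiffAt_iff_target]
  refine ⟨continuousAt_pi.2 fun i => (h i x).continuousAt, ?_⟩
  refine contMDiffAt_pi_space.2 fun i => ?_
  exact ((contMDiffAt_iff_target.1 (h i x)).2)

theorem contMDiff_eval (i : ι) [∀ i, IsManifold (I i) ∞ (M i)] [∀ i, (I i).Boundaryless] :
    ContMDiff (ModelWithCorners.pi I) (I i) ∞ fun x : ∀ i, M i => x i := by
  intro x
  rw [contMDiffAt_iff]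
  refine ⟨(continuous_apply i).continuousAt, ?_⟩
  have h : ContDiff ℝ ∞ (fun y : (∀ i, E i) => y i) :=
    (ContinuousLinearMap.proj (R := ℝ) (φ := E) i).contDiff
  refine (h.contDiffAt.congr_of_eventuallyEq ?_).contDiffWithinAt
  filter_upwards [(isOpen_extChartAt_target (I := ModelWithCorners.pi I) x).mem_nhds
    (mem_extChartAt_target x)] with y hy
  exact congrFun ((extChartAt (ModelWithCorners.pi I) x).right_inv hy) i

end Pi

section Nerve

variable {V : Type*} [NormedAddCommGroup V] [NormedSpace ℝ V]
  {W : Type*} [NormedAddCommGroup W] [NormedSpace ℝ W]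
  {G : Type*} [TopologicalSpace G] [ChartedSpace V G] [Group G]
  {H : Type*} [TopologicalSpace H] [ChartedSpace W H] [Group H]

variable (V W G H) in
/-- A crossed module of Lie groups `bd : G → H`, with right action `(g, h) ↦ g^h = act g h`. -/
structure LieCrossedModule where
  bd : G →* H
  contMDiff_bd : ContMDiff 𝓘(ℝ, V) 𝓘(ℝ, W) ∞ bd
  act : G → H → G
  contMDiff_act : ContMDiff (𝓘(ℝ, V).prod 𝓘(ℝ, W)) 𝓘(ℝ, V) ∞ fun x : G × H => act x.1 x.2
  mul_act : ∀ (x y : G) (h : H), act (x * y) h = act x h * act y h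
  act_one : ∀ x : G, act x 1 = x
  act_mul : ∀ (x : G) (h k : H), act x (h * k) = act (act x h) k
  bd_act : ∀ (x : G) (h : H), bd (act x h) = h⁻¹ * bd x * h
  act_bd : ∀ x y : G, act x (bd y) = y⁻¹ * x * y

namespace LieCrossedModule

variable (X : LieCrossedModule V W G H)

theorem one_act (h : H) : X.act 1 h = 1 := by
  have := X.mul_act 1 1 h
  simpa using this

theorem inv_act (x : G) (h : H) : X.act x⁻¹ h = (X.act x h)⁻¹ := by
  rw [eq_inv_iff_mul_eq_one, ← X.mul_act, inv_mul_cancel, X.one_act]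

/-- A `q`-simplex of the geometric nerve of the 2-group `G ⋊ H ⇉ H ⇉ *`, with vertices
`0, …, q`: the edge from `a` to `b` is labelled by a 1-arrow `edge a b ∈ H`, the triangle `a b c`
by the 2-arrow `(tri a b c, edge a b * edge b c) : edge a b * edge b c ⇒ edge a c` (recall that
`(g, h)` has source `h` and target `h * bd g`), and every tetrahedron `a b c d` commutes, i.e.
`(α_{abc} * edge c d) ⋆ α_{acd} = (edge a b * α_{bcd}) ⋆ α_{abd}`; the `G`-components of the two
sides are those in `tetra`, and their sources agree automatically. -/
@[ext]
structure Simplex (q : ℕ) where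
  edge : ∀ a b : Fin (q + 1), a < b → H
  tri : ∀ a b c : Fin (q + 1), a < b → b < c → G
  target_eq : ∀ a b c hab hbc,
    edge a b hab * edge b c hbc * X.bd (tri a b c hab hbc) = edge a c (hab.trans hbc)
  tetra : ∀ a b c d hab hbc hcd,
    X.act (tri a b c hab hbc) (edge c d hcd) * tri a c d (hab.trans hbc) hcd =
      tri b c d hbc hcd * tri a b d hab (hbc.trans hcd)

/-- The `i`-th face of a simplex: restriction to the vertices different from `i`. -/
def Simplex.face {q : ℕ} (i : Fin (q + 2)) (σ : X.Simplex (q + 1)) : X.Simplex q where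
  edge a b hab := σ.edge (i.succAbove a) (i.succAbove b) (Fin.strictMono_succAbove i hab)
  tri a b c hab hbc := σ.tri (i.succAbove a) (i.succAbove b) (i.succAbove c)
    (Fin.strictMono_succAbove i hab) (Fin.strictMono_succAbove i hbc)
  target_eq _ _ _ _ _ := σ.target_eq _ _ _ _ _
  tetra _ _ _ _ _ _ _ := σ.tetra _ _ _ _ _ _ _

variable (G H) in
/-- The manifold `N_q ≅ H^q × G^{q(q-1)/2}` of `q`-simplices of the nerve, in the coordinates
given by the edges `0 → j + 1` (for `j < q`) and the triangles `0, j + 1, k + 1`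
(for `j < k < q`), which determine the simplex; see `simplexEquiv`. -/
abbrev N (q : ℕ) : Type _ := (Fin q → H) × ({e : Fin q × Fin q // e.1 < e.2} → G)

/-- The edge `0 → a`, which is `1` for `a = 0`. -/
def coordEdge {q : ℕ} (x : N G H q) : Fin (q + 1) → H := Fin.cons 1 x.1

/-- The triangle `0, a, b`, which is `1` for `a = 0` (and by convention if not `a < b`). -/
def coordTri {q : ℕ} (x : N G H q) : Fin (q + 1) → Fin (q + 1) → G :=
  Fin.cons (fun _ => 1) fun j => Fin.cons 1 fun k => if h : j < k then x.2 ⟨(j, k), h⟩ else 1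

/-- The edge `a → b` of the simplex with the given coordinates. -/
def edgeOf {q : ℕ} (x : N G H q) (a b : Fin (q + 1)) : H :=
  (coordEdge x a)⁻¹ * coordEdge x b * (X.bd (coordTri x a b))⁻¹

/-- The triangle `a, b, c` of the simplex with the given coordinates. -/
def triOf {q : ℕ} (x : N G H q) (a b c : Fin (q + 1)) : G :=
  X.act (coordTri x a b) (X.edgeOf x b c) * coordTri x b c * (coordTri x a c)⁻¹

theorem edgeOf_mul {q : ℕ} (x : N G H q) (a b c : Fin (q + 1)) :
    X.edgeOf x a b * X.edgeOf x b c * X.bd (X.triOf x a b c) = X.edgeOf x a c := by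
  simp only [triOf, map_mul, map_inv, X.bd_act, edgeOf]
  group

theorem triOf_mul {q : ℕ} (x : N G H q) (a b c d : Fin (q + 1)) :
    X.act (X.triOf x a b c) (X.edgeOf x c d) * X.triOf x a c d =
      X.triOf x b c d * X.triOf x a b d := by
  have h1 : X.triOf x a b d = X.act (X.act (coordTri x a b) (X.edgeOf x b c * X.edgeOf x c d))
      (X.bd (X.triOf x b c d)) * coordTri x b d * (coordTri x a d)⁻¹ := by
    rw [← X.act_mul, X.edgeOf_mul]
    rfl
  rw [h1, X.act_bd]
  simp only [triOf, X.mul_act, X.inv_act, X.act_mul]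
  group

/-- The nerve coordinates: `N_q` is the set of `q`-simplices. -/
def simplexEquiv (q : ℕ) : N G H q ≃ X.Simplex q where
  toFun x :=
    { edge := fun a b _ => X.edgeOf x a b
      tri := fun a b c _ _ => X.triOf x a b c
      target_eq := fun a b c _ _ => X.edgeOf_mul x a b c
      tetra := fun a b c d _ _ _ => X.triOf_mul x a b c d }
  invFun σ := (fun j => σ.edge 0 j.succ j.succ_pos,
    fun e => σ.tri 0 e.1.1.succ e.1.2.succ (Fin.succ_pos _) (Fin.succ_lt_succ_iff.2 e.2))
  left_inv x := by
    refine Prod.ext (funext fun j => ?_) (funext fun e => ?_)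
    · simp [edgeOf, coordEdge, coordTri]
    · simp [triOf, coordTri, X.one_act, e.2]
  right_inv σ := by
    set x : N G H q := (fun j => σ.edge 0 j.succ j.succ_pos,
      fun e => σ.tri 0 e.1.1.succ e.1.2.succ (Fin.succ_pos _) (Fin.succ_lt_succ_iff.2 e.2))
    have hE : ∀ a b (hab : a < b), X.edgeOf x a b = σ.edge a b hab := by
      intro a b hab
      obtain ⟨k, rfl⟩ := Fin.exists_succ_eq_of_ne_zero (Fin.ne_zero_of_lt hab)
      cases a using Fin.cases with
      | zero => simp [edgeOf, coordEdge, coordTri, x]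
      | succ j =>
        have hjk : j < k := Fin.succ_lt_succ_iff.1 hab
        have := σ.target_eq 0 j.succ k.succ j.succ_pos hab
        simp only [edgeOf, coordEdge, coordTri, x, Fin.cons_succ, hjk, dif_pos]
        rw [← this]
        group
    have hT : ∀ a b c (hab : a < b) (hbc : b < c), X.triOf x a b c = σ.tri a b c hab hbc := by
      intro a b c hab hbc
      obtain ⟨k, rfl⟩ := Fin.exists_succ_eq_of_ne_zero (Fin.ne_zero_of_lt hab)
      obtain ⟨l, rfl⟩ := Fin.exists_succ_eq_of_ne_zero (Fin.ne_zero_of_lt hbc)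
      have hkl : k < l := Fin.succ_lt_succ_iff.1 hbc
      cases a using Fin.cases with
      | zero => simp [triOf, coordTri, X.one_act, x, hkl]
      | succ j =>
        have hjk : j < k := Fin.succ_lt_succ_iff.1 hab
        have := σ.tetra 0 j.succ k.succ l.succ j.succ_pos hab hbc
        simp only [triOf, hE _ _ hbc, coordTri, x, Fin.cons_succ, hjk, hkl, hjk.trans hkl, dif_pos]
        rw [this]
        group
    ext a b hab
    · exact hE a b hab
    · exact hT _ _ _ _ _

variable [LieGroup 𝓘(ℝ, V) ∞ G] [LieGroup 𝓘(ℝ, W) ∞ H]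

variable (V W) in
/-- The model with corners of the manifold `N_q`. -/
abbrev modelN (q : ℕ) :=
  (ModelWithCorners.pi fun _ : Fin q => 𝓘(ℝ, W)).prod
    (ModelWithCorners.pi fun _ : {e : Fin q × Fin q // e.1 < e.2} => 𝓘(ℝ, V))

/-- The face map `d_i : N_{q+1} → N_q`, in coordinates. -/
def faceFun {q : ℕ} (i : Fin (q + 2)) (x : N G H (q + 1)) : N G H q :=
  (X.simplexEquiv q).symm (Simplex.face X i (X.simplexEquiv (q + 1) x))

theorem contMDiff_coordEdge {q : ℕ} (a : Fin (q + 1)) :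
    ContMDiff (modelN V W q) 𝓘(ℝ, W) ∞ fun x : N G H q => coordEdge x a := by
  cases a using Fin.cases with
  | zero => exact contMDiff_const
  | succ j =>
    exact (contMDiff_eval (I := fun _ : Fin q => 𝓘(ℝ, W)) (M := fun _ => H) j).comp contMDiff_fst

theorem contMDiff_coordTri {q : ℕ} (a b : Fin (q + 1)) :
    ContMDiff (modelN V W q) 𝓘(ℝ, V) ∞ fun x : N G H q => coordTri x a b := by
  cases a using Fin.cases with
  | zero => exact contMDiff_const
  | succ j =>
    cases b using Fin.cases with
    | zero => exact contMDiff_const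
    | succ k =>
      by_cases h : j < k
      · simp only [coordTri, Fin.cons_succ, h, dif_pos]
        exact (contMDiff_eval (I := fun _ : {e : Fin q × Fin q // e.1 < e.2} => 𝓘(ℝ, V))
          (M := fun _ => G) ⟨(j, k), h⟩).comp contMDiff_snd
      · simp only [coordTri, Fin.cons_succ, h, dif_neg, not_false_eq_true]
        exact contMDiff_const

theorem contMDiff_edgeOf {q : ℕ} (a b : Fin (q + 1)) :
    ContMDiff (modelN V W q) 𝓘(ℝ, W) ∞ fun x : N G H q => X.edgeOf x a b :=
  ((contMDiff_coordEdge a).inv.mul (contMDiff_coordEdge b)).mul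
    (X.contMDiff_bd.comp (contMDiff_coordTri a b)).inv

theorem contMDiff_triOf {q : ℕ} (a b c : Fin (q + 1)) :
    ContMDiff (modelN V W q) 𝓘(ℝ, V) ∞ fun x : N G H q => X.triOf x a b c :=
  ((X.contMDiff_act.comp ((contMDiff_coordTri a b).prodMk (X.contMDiff_edgeOf b c))).mul
    (contMDiff_coordTri b c)).mul (contMDiff_coordTri a c).inv

/-- The face map `d_i : N_{q+1} → N_q` as a smooth map. -/
def face {q : ℕ} (i : Fin (q + 2)) :
    C^∞⟮modelN V W (q + 1), N G H (q + 1); modelN V W q, N G H q⟯ where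
  val := X.faceFun i
  property := ContMDiff.prodMk
    (contMDiff_pi fun _ => X.contMDiff_edgeOf _ _) (contMDiff_pi fun _ => X.contMDiff_triOf _ _ _)

theorem Simplex.edge_congr {q : ℕ} (σ : X.Simplex q) {a b a' b' : Fin (q + 1)} (ha : a = a')
    (hb : b = b') (h : a < b) (h' : a' < b') : σ.edge a b h = σ.edge a' b' h' := by
  subst ha hb
  rfl

theorem Simplex.tri_congr {q : ℕ} (σ : X.Simplex q) {a b c a' b' c' : Fin (q + 1)} (ha : a = a')
    (hb : b = b') (hc : c = c') (h : a < b) (h₂ : b < c) (h' : a' < b') (h₂' : b' < c') :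
    σ.tri a b c h h₂ = σ.tri a' b' c' h' h₂' := by
  subst ha hb hc
  rfl

theorem succAbove_comm {q : ℕ} {i j : Fin (q + 2)} (hij : i ≤ j) (a : Fin (q + 1)) :
    j.succ.succAbove (i.succAbove a) = i.castSucc.succAbove (j.succAbove a) := by
  have := congrArg (fun f => f.toOrderHom a) (SimplexCategory.δ_comp_δ hij)
  exact this

/-- The simplicial identity for iterated faces. -/
theorem face_face {q : ℕ} {i j : Fin (q + 2)} (hij : i ≤ j) :
    (X.face i).comp (X.face j.succ) = (X.face j).comp (X.face (q := q + 1) i.castSucc) := by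
  refine Subtype.ext (funext fun x => ?_)
  change X.faceFun i (X.faceFun j.succ x) = X.faceFun j (X.faceFun i.castSucc x)
  simp only [faceFun, Equiv.apply_symm_apply]
  congr 1
  refine Simplex.ext (funext fun a => funext fun b => funext fun hab => ?_)
    (funext fun a => funext fun b => funext fun c => funext fun hab => funext fun hbc => ?_)
  · exact Simplex.edge_congr X (X.simplexEquiv (q + 2) x) (succAbove_comm hij a)
      (succAbove_comm hij b)
      (Fin.strictMono_succAbove _ (Fin.strictMono_succAbove _ hab))
      (Fin.strictMono_succAbove _ (Fin.strictMono_succAbove _ hab))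
  · exact Simplex.tri_congr X (X.simplexEquiv (q + 2) x) (succAbove_comm hij a)
      (succAbove_comm hij b) (succAbove_comm hij c)
      (Fin.strictMono_succAbove _ (Fin.strictMono_succAbove _ hab))
      (Fin.strictMono_succAbove _ (Fin.strictMono_succAbove _ hbc))
      (Fin.strictMono_succAbove _ (Fin.strictMono_succAbove _ hab))
      (Fin.strictMono_succAbove _ (Fin.strictMono_succAbove _ hbc))

variable (V W G H) in
/-- The space `Ω^p(N_q)` of smooth `p`-forms on the manifold of `q`-simplices. -/
def Form (p q : ℕ) : Type _ := DForm (modelN V W q) (N G H q) p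

instance (p q : ℕ) : AddCommGroup (Form V W G H p q) :=
  inferInstanceAs (AddCommGroup (DForm (modelN V W q) (N G H q) p))

instance (p q : ℕ) : Module ℝ (Form V W G H p q) :=
  inferInstanceAs (Module ℝ (DForm (modelN V W q) (N G H q) p))

/-- The underlying field of alternating forms. -/
def Form.raw {p q : ℕ} (α : Form V W G H p q) : RawForm (modelN V W q) (N G H q) p := α.1

/-- The de Rham differential `d_dR : Ω^p(N_q) → Ω^{p+1}(N_q)`. -/
def dForm (p q : ℕ) : Form V W G H p q →ₗ[ℝ] Form V W G H (p + 1) q :=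
  dR (I := modelN V W q) (M := N G H q) (p := p)

/-- The pullback `d_i^* : Ω^p(N_q) → Ω^p(N_{q+1})` along the face map. -/
def coface (p q : ℕ) (i : Fin (q + 2)) : Form V W G H p q →ₗ[ℝ] Form V W G H p (q + 1) :=
  pullback (p := p) (X.face i)

theorem dForm_dForm (p q : ℕ) (α : Form V W G H p q) : dForm (p + 1) q (dForm p q α) = 0 :=
  dR_dR (I := modelN V W q) (M := N G H q) α

theorem dForm_coface (p q : ℕ) (i : Fin (q + 2)) (α : Form V W G H p q) :
    dForm p (q + 1) (X.coface p q i α) = X.coface (p + 1) q i (dForm p q α) :=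
  dR_pullback (X.face i) α

theorem coface_coface (p q : ℕ) {i j : Fin (q + 2)} (hij : i ≤ j) (α : Form V W G H p q) :
    X.coface p (q + 1) j.succ (X.coface p q i α) =
      X.coface p (q + 1) i.castSucc (X.coface p q j α) := by
  have h1 := pullback_comp (X.face i) (X.face j.succ) α
  have h2 := pullback_comp (X.face j) (X.face i.castSucc) α
  rw [X.face_face hij] at h1
  exact h1.trans h2.symm

/-- The simplicial differential `∂ = (-1)^p ∑ (-1)^i d_i^* : Ω^p(N_q) → Ω^p(N_{q+1})`. -/
def del (p q : ℕ) : Form V W G H p q →ₗ[ℝ] Form V W G H p (q + 1) :=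
  (-1 : ℝ) ^ p • ∑ i : Fin (q + 2), (-1 : ℝ) ^ (i : ℕ) • X.coface p q i

theorem del_apply (p q : ℕ) (α : Form V W G H p q) :
    X.del p q α = (-1 : ℝ) ^ p • ∑ i : Fin (q + 2), (-1 : ℝ) ^ (i : ℕ) • X.coface p q i α := by
  simp [del]

theorem del_del (p q : ℕ) (α : Form V W G H p q) : X.del p (q + 1) (X.del p q α) = 0 := by
  have key : ∑ j : Fin (q + 3), (-1 : ℝ) ^ (j : ℕ) • X.coface p (q + 1) j
      (∑ i : Fin (q + 2), (-1 : ℝ) ^ (i : ℕ) • X.coface p q i α) = 0 := by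
    simp only [map_sum, map_smul, Finset.smul_sum, smul_smul, ← pow_add]
    rw [← Finset.sum_product']
    let P := Fin (q + 3) × Fin (q + 2)
    let S : Finset P := {ij : P | (ij.1 : ℕ) ≤ (ij.2 : ℕ)}
    rw [Finset.univ_product_univ, ← Finset.sum_add_sum_compl S, ← eq_neg_iff_add_eq_zero,
      ← Finset.sum_neg_distrib]
    let φ : ∀ ij : P, ij ∈ S → P := fun ij hij =>
      (ij.2.succ, Fin.castLT ij.1 (lt_of_le_of_lt (Finset.mem_filter.mp hij).right ij.2.is_lt))
    apply Finset.sum_bij φ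
    · intro ij hij
      simp_rw [S, φ, Finset.compl_filter, Finset.mem_filter_univ, Fin.val_succ,
        Fin.val_castLT] at hij ⊢
      omega
    · rintro ⟨i, j⟩ hij ⟨i', j'⟩ hij' h
      have e1 : j.succ = j'.succ := congrArg Prod.fst h
      have e2 : i.val = i'.val := congrArg (fun z => z.2.val) h
      exact Prod.ext (Fin.ext e2) (Fin.succ_injective _ e1)
    · rintro ⟨i', j'⟩ hij'
      simp_rw [S, Finset.compl_filter, Finset.mem_filter_univ, not_le] at hij'
      refine ⟨(Fin.castSucc j', i'.pred ?_), ?_, ?_⟩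
      · rintro rfl
        simp only [Fin.val_zero, not_lt_zero] at hij'
      · simp only [S, Finset.mem_filter_univ, Fin.val_castSucc, Fin.val_pred]
        omega
      · simp only [φ, Fin.castLT_castSucc, Fin.succ_pred]
    · rintro ⟨i, j⟩ hij
      have hij' : (i : ℕ) ≤ j := (Finset.mem_filter.mp hij).right
      obtain ⟨k, rfl⟩ : ∃ k : Fin (q + 2), i = k.castSucc :=
        ⟨i.castLT (lt_of_le_of_lt hij' j.is_lt), rfl⟩
      have hkj : k ≤ j := hij'
      simp only [φ, Fin.castLT_castSucc, Fin.val_succ, Fin.val_castSucc]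
      rw [X.coface_coface p q hkj, ← neg_smul]
      congr 1
      ring
  rw [X.del_apply p (q + 1), X.del_apply p q]
  simp only [map_smul]
  have e : ∀ j : Fin (q + 3), (-1 : ℝ) ^ (j : ℕ) • (-1 : ℝ) ^ p • X.coface p (q + 1) j
      (∑ i : Fin (q + 2), (-1 : ℝ) ^ (i : ℕ) • X.coface p q i α) =
      (-1 : ℝ) ^ p • (-1 : ℝ) ^ (j : ℕ) • X.coface p (q + 1) j
      (∑ i : Fin (q + 2), (-1 : ℝ) ^ (i : ℕ) • X.coface p q i α) := fun j => smul_comm _ _ _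
  rw [Finset.sum_congr rfl fun j _ => e j, ← Finset.smul_sum, key, smul_zero, smul_zero]

theorem dForm_del (p q : ℕ) (α : Form V W G H p q) :
    dForm p (q + 1) (X.del p q α) + X.del (p + 1) q (dForm p q α) = 0 := by
  simp only [del_apply, map_smul, map_sum, X.dForm_coface, pow_succ, mul_neg, mul_one, neg_smul]
  exact add_neg_cancel _

variable (V W G H) in
/-- The degree `n` part `⨁_{p + q = n} Ω^p(N_q)` of the total complex. -/
def Tot (n : ℕ) : Type _ := ∀ e : {e : ℕ × ℕ // e.1 + e.2 = n}, Form V W G H e.1.1 e.1.2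

instance (n : ℕ) : AddCommGroup (Tot V W G H n) :=
  inferInstanceAs (AddCommGroup (∀ e : {e : ℕ × ℕ // e.1 + e.2 = n}, Form V W G H e.1.1 e.1.2))

instance (n : ℕ) : Module ℝ (Tot V W G H n) :=
  inferInstanceAs (Module ℝ (∀ e : {e : ℕ × ℕ // e.1 + e.2 = n}, Form V W G H e.1.1 e.1.2))

/-- The component in `Ω^p(N_q)` of `d_dR α`, for `α` of total degree `n`. -/
def dComp (n : ℕ) : ∀ p q : ℕ, p + q = n + 1 → Tot V W G H n → Form V W G H p q
  | 0, _, _, _ => 0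
  | p + 1, q, h, α => dForm p q (α ⟨(p, q), by omega⟩)

/-- The component in `Ω^p(N_q)` of `∂ α`, for `α` of total degree `n`. -/
def delComp (n : ℕ) : ∀ p q : ℕ, p + q = n + 1 → Tot V W G H n → Form V W G H p q
  | _, 0, _, _ => 0
  | p, q + 1, h, α => X.del p q (α ⟨(p, q), by omega⟩)

theorem dComp_add (n p q : ℕ) (h : p + q = n + 1) (α β : Tot V W G H n) :
    dComp n p q h (α + β) = dComp n p q h α + dComp n p q h β := by
  cases p with
  | zero => exact (add_zero 0).symm
  | succ p => exact map_add (dForm p q) _ _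

theorem dComp_smul (n p q : ℕ) (h : p + q = n + 1) (c : ℝ) (α : Tot V W G H n) :
    dComp n p q h (c • α) = c • dComp n p q h α := by
  cases p with
  | zero => exact (smul_zero c).symm
  | succ p => exact map_smul (dForm p q) c _

theorem delComp_add (n p q : ℕ) (h : p + q = n + 1) (α β : Tot V W G H n) :
    X.delComp n p q h (α + β) = X.delComp n p q h α + X.delComp n p q h β := by
  cases q with
  | zero => exact (add_zero 0).symm
  | succ q => exact map_add (X.del p q) _ _

theorem delComp_smul (n p q : ℕ) (h : p + q = n + 1) (c : ℝ) (α : Tot V W G H n) :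
    X.delComp n p q h (c • α) = c • X.delComp n p q h α := by
  cases q with
  | zero => exact (smul_zero c).symm
  | succ q => exact map_smul (X.del p q) c _

/-- The total differential `d_dR + ∂`. -/
def totD (n : ℕ) : Tot V W G H n →ₗ[ℝ] Tot V W G H (n + 1) where
  toFun α e := dComp n e.1.1 e.1.2 e.2 α + X.delComp n e.1.1 e.1.2 e.2 α
  map_add' α β := by
    funext e
    change _ = (dComp n e.1.1 e.1.2 e.2 α + X.delComp n e.1.1 e.1.2 e.2 α) +
      (dComp n e.1.1 e.1.2 e.2 β + X.delComp n e.1.1 e.1.2 e.2 β)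
    rw [dComp_add, delComp_add, add_add_add_comm]
  map_smul' c α := by
    funext e
    change _ = c • (dComp n e.1.1 e.1.2 e.2 α + X.delComp n e.1.1 e.1.2 e.2 α)
    rw [dComp_smul, delComp_smul, smul_add]

theorem totD_totD (n : ℕ) (α : Tot V W G H n) : X.totD (n + 1) (X.totD n α) = 0 := by
  funext e
  obtain ⟨⟨p, q⟩, h⟩ := e
  change dComp (n + 1) p q h (fun e => dComp n e.1.1 e.1.2 e.2 α + X.delComp n e.1.1 e.1.2 e.2 α) +
    X.delComp (n + 1) p q h
      (fun e => dComp n e.1.1 e.1.2 e.2 α + X.delComp n e.1.1 e.1.2 e.2 α) = 0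
  have h1 : ∀ p q (h : p + 1 + (q + 1) = n + 1 + 1),
      dForm p (q + 1) (X.delComp n p (q + 1) (by omega) α) +
        X.del (p + 1) q (dComp n (p + 1) q (by omega) α) = 0 := fun p q h =>
    X.dForm_del p q (α ⟨(p, q), by omega⟩)
  have h2 : ∀ p q (h : p + 1 + q = n + 1 + 1), dForm p q (dComp n p q (by omega) α) = 0 := by
    intro p q h
    cases p with
    | zero => exact map_zero _
    | succ p => exact dForm_dForm _ _ _
  have h3 : ∀ p q (h : p + (q + 1) = n + 1 + 1), X.del p q (X.delComp n p q (by omega) α) = 0 := by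
    intro p q h
    cases q with
    | zero => exact map_zero _
    | succ q => exact X.del_del _ _ _
  cases p with
  | zero =>
    cases q with
    | zero => simp at h
    | succ q =>
      have e0 : X.del 0 q (dComp n 0 q (by simp only at h; omega) α) = 0 := map_zero _
      change 0 + X.del 0 q (dComp n 0 q (by simp only at h; omega) α +
        X.delComp n 0 q (by simp only at h; omega) α) = 0
      rw [map_add, h3 0 q h, e0, add_zero, add_zero]
  | succ p =>
    cases q with
    | zero =>
      have e0 : dForm p 0 (X.delComp n p 0 (by simp only at h; omega) α) = 0 := map_zero _
      change dForm p 0 (dComp n p 0 (by simp only at h; omega) α +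
        X.delComp n p 0 (by simp only at h; omega) α) + 0 = 0
      rw [map_add, h2 p 0 h, e0, add_zero, add_zero]
    | succ q =>
      change dForm p (q + 1) (dComp n p (q + 1) (by simp only at h; omega) α +
        X.delComp n p (q + 1) (by simp only at h; omega) α) +
        X.del (p + 1) q (dComp n (p + 1) q (by simp only at h; omega) α +
        X.delComp n (p + 1) q (by simp only at h; omega) α) = 0
      rw [map_add, map_add, h2 p (q + 1) h, h3 (p + 1) q h, zero_add, add_zero]
      exact h1 p q h

/-- The total complex `(Ω^•_tot([G → H]), d_dR + ∂)` as a cochain complex of real vector spaces. -/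
def totComplex : CochainComplex (ModuleCat ℝ) ℕ :=
  CochainComplex.of (fun n => ModuleCat.of ℝ (Tot V W G H n))
    (fun n => ModuleCat.ofHom (X.totD n)) fun n => by
      ext α : 2
      exact X.totD_totD n α

/-- The identification `N_2 ≅ G × H × H`: a 2-simplex given by `f₀ = edge 1 2`, `f₁ = edge 0 2`,
`f₂ = edge 0 1` and the 2-arrow `α = (g, h) : f₂ * f₀ = h ⇒ f₁` corresponds to `(g, h, f₀)`. -/
def nerveTwo : Diffeomorph (modelN V W 2) (𝓘(ℝ, V).prod (𝓘(ℝ, W).prod 𝓘(ℝ, W)))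
    (N G H 2) (G × H × H) ∞ where
  toFun x := (X.triOf x 0 1 2, X.edgeOf x 0 1 * X.edgeOf x 1 2, X.edgeOf x 1 2)
  invFun y := (![y.2.1 * y.2.2⁻¹, y.2.1 * X.bd y.1], fun _ => y.1)
  left_inv x := by
    refine Prod.ext (funext fun j => ?_) (funext fun e => ?_)
    · fin_cases j
      · simp
        simp [edgeOf, coordEdge, coordTri]
      · have := X.edgeOf_mul x 0 1 2
        simp [this]
        simp [edgeOf, coordEdge, coordTri]
        rfl
    · obtain ⟨⟨a, b⟩, hab⟩ := e
      fin_cases a <;> fin_cases b <;> simp at hab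
      simp [triOf, coordTri, X.one_act]
      rfl
  right_inv y := by
    have e01 : X.edgeOf (q := 2) ((![y.2.1 * y.2.2⁻¹, y.2.1 * X.bd y.1], fun _ => y.1) : N G H 2)
        0 1 = y.2.1 * y.2.2⁻¹ := by
      change 1⁻¹ * (y.2.1 * y.2.2⁻¹) * (X.bd 1)⁻¹ = _
      simp
    have e12 : X.edgeOf (q := 2) ((![y.2.1 * y.2.2⁻¹, y.2.1 * X.bd y.1], fun _ => y.1) : N G H 2)
        1 2 = y.2.2 := by
      change (y.2.1 * y.2.2⁻¹)⁻¹ * (y.2.1 * X.bd y.1) * (X.bd y.1)⁻¹ = _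
      group
    have t : X.triOf (q := 2) ((![y.2.1 * y.2.2⁻¹, y.2.1 * X.bd y.1], fun _ => y.1) : N G H 2)
        0 1 2 = y.1 := by
      change X.act 1 _ * y.1 * 1⁻¹ = _
      simp [X.one_act]
    refine Prod.ext t (Prod.ext ?_ e12)
    simp only [e01, e12, inv_mul_cancel_right]
  contMDiff_toFun := (X.contMDiff_triOf _ _ _).prodMk
    (((X.contMDiff_edgeOf _ _).mul (X.contMDiff_edgeOf _ _)).prodMk (X.contMDiff_edgeOf _ _))
  contMDiff_invFun := by
    have h1 : ContMDiff (𝓘(ℝ, V).prod (𝓘(ℝ, W).prod 𝓘(ℝ, W))) 𝓘(ℝ, V) ∞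
        fun y : G × H × H => y.1 := contMDiff_fst
    have h2 : ContMDiff (𝓘(ℝ, V).prod (𝓘(ℝ, W).prod 𝓘(ℝ, W))) 𝓘(ℝ, W) ∞
        fun y : G × H × H => y.2.1 := contMDiff_fst.comp contMDiff_snd
    have h3 : ContMDiff (𝓘(ℝ, V).prod (𝓘(ℝ, W).prod 𝓘(ℝ, W))) 𝓘(ℝ, W) ∞
        fun y : G × H × H => y.2.2 := contMDiff_snd.comp contMDiff_snd
    refine ContMDiff.prodMk (contMDiff_pi fun j => ?_) (contMDiff_pi fun _ => h1)
    fin_cases j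
    · exact h2.mul h3.inv
    · exact h2.mul (X.contMDiff_bd.comp h1)

variable (V G) in
/-- The left invariant 1-form `ξ^L` on `G` with value `ξ ∈ 𝔤^*` at the identity. -/
def leftInvariantForm (ξ : GroupLieAlgebra 𝓘(ℝ, V) G →L[ℝ] ℝ) : RawForm 𝓘(ℝ, V) G 1 := fun g =>
  ContinuousAlternatingMap.ofSubsingleton ℝ (TangentSpace 𝓘(ℝ, V) g) ℝ (0 : Fin 1)
    ((ξ : V →L[ℝ] ℝ).comp (mfderiv 𝓘(ℝ, V) 𝓘(ℝ, V) (fun x : G => g⁻¹ * x) g : V →L[ℝ] V))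

/-- The space `(𝔤^*)^{𝔤,H}` of linear forms on `𝔤` that are invariant under `𝔤` and `H`. -/
def invDual : Submodule ℝ (GroupLieAlgebra 𝓘(ℝ, V) G →L[ℝ] ℝ) where
  carrier := {ξ | (∀ x y : GroupLieAlgebra 𝓘(ℝ, V) G, ξ ⁅x, y⁆ = 0) ∧
    ∀ (h : H) (x : V), (ξ : V →L[ℝ] ℝ)
      ((mfderiv 𝓘(ℝ, V) 𝓘(ℝ, V) (fun g : G => X.act g h) 1 : V →L[ℝ] V) x) = (ξ : V →L[ℝ] ℝ) x}
  zero_mem' := ⟨fun _ _ => rfl, fun _ _ => rfl⟩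
  add_mem' := fun {ξ β} hξ hβ => ⟨fun x y => by
    rw [add_apply, hξ.1, hβ.1, add_zero], fun h x =>
      congrArg₂ (· + ·) (hξ.2 h x) (hβ.2 h x)⟩
  smul_mem' := fun c ξ hξ => ⟨fun x y => by
    rw [smul_apply, hξ.1, smul_zero], fun h x =>
      congrArg (c • ·) (hξ.2 h x)⟩

end LieCrossedModule
end Nerve
end LieTwo

end

/-!
Call a form `θ` on `G` multiplicative if `f ↦ f^* θ` is a homomorphism on smooth maps to `G`. Such a
form of degree at least two vanishes, since it is left invariant and its value at `1` is `0`; as `d`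
preserves multiplicativity, a multiplicative `1`-form is closed. For invariant `ξ` the left
invariant form `θ = ξ^L` is also right invariant, hence multiplicative: this gives `dI(ξ) = 0`.

The action `act : G × H → G` satisfies `act^* θ = pr₁^* θ` exactly when the orbit forms
`orbit_g^* θ` on `H` vanish, and by equivariance it suffices to check this at `1 ∈ H`. There
`g ↦ (orbit_g^* θ)_1` is a homomorphism from `G` to the additive group of `𝔥^*`. It is locally
constant because `act^* θ` is closed and restricts to the same form `θ` on every slice `G × {h}`,
and it vanishes on the image of `di` because `orbit_g ∘ i` is `x ↦ x⁻¹ g x`. Either hypothesis of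
the theorem thus makes it zero, and then pulling `θ` back along the two sides of the tetrahedron
identity `g_{abc}^{f_{cd}} g_{acd} = g_{bcd} g_{abd}` gives `∂I(ξ) = 0`.
-/

noncomputable section

namespace LieTwo

section Forms

variable {E : Type*} [NormedAddCommGroup E] [NormedSpace ℝ E] {B : Type*} [TopologicalSpace B]
  {I : ModelWithCorners ℝ E B} {M : Type*} [TopologicalSpace M] [ChartedSpace B M]
  {E' : Type*} [NormedAddCommGroup E'] [NormedSpace ℝ E'] {B' : Type*} [TopologicalSpace B']
  {I' : ModelWithCorners ℝ E' B'} {M' : Type*} [TopologicalSpace M'] [ChartedSpace B' M']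
  {p : ℕ}

/-- The inclusion `x ↦ (x, y)` of the slice `M × {y}`. -/
def sliceLeft (y : M') : C^∞⟮I, M; I.prod I', M × M'⟯ :=
  ContMDiffMap.id.prodMk (ContMDiffMap.const y)

/-- The inclusion `y ↦ (x, y)` of the slice `{x} × M'`. -/
def sliceRight (x : M) : C^∞⟮I', M'; I.prod I', M × M'⟯ :=
  (ContMDiffMap.const x).prodMk ContMDiffMap.id

section ProdDerivative

variable {Ω : E × E' → (E × E') [⋀^Fin 1]→L[ℝ] ℝ} {k : E'} {u : E}

/-- The value of `dΩ` on `(v, 0), (0, w)` is `∂_v Ω(0, w) - ∂_w Ω(v, 0)`. -/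
theorem hasFDerivAt_inr_component_zero (hΩ : DifferentiableAt ℝ Ω (u, k))
    (hclosed : extDeriv Ω (u, k) = 0)
    (hleft : ∀ v : E, ∀ᶠ k' in 𝓝 k, Ω (u, k') (fun _ => (v, 0)) = Ω (u, k) (fun _ => (v, 0)))
    (w : E') :
    HasFDerivAt (fun u' => Ω (u', k) (fun _ => (0, w))) (0 : E →L[ℝ] ℝ) u := by
  have hΩ_apply (m : Fin 1 → E × E') : DifferentiableAt ℝ (fun z => Ω z m) (u, k) :=
    (ContinuousAlternatingMap.apply ℝ (E × E') ℝ m).differentiableAt.comp (u, k) hΩ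
  have hright : HasFDerivAt (fun u' => Ω (u', k) (fun _ => (0, w)))
      ((fderiv ℝ (fun z => Ω z fun _ => (0, w)) (u, k)).comp (.inl ℝ E E')) u :=
    (hΩ_apply fun _ => (0, w)).hasFDerivAt.comp (f := fun u' => (u', k)) u
      (hasFDerivAt_prodMk_left u k)
  refine hright.congr_fderiv (ContinuousLinearMap.ext fun v => ?_)
  have hvert : fderiv ℝ (fun z => Ω z fun _ => (v, 0)) (u, k) (0, w) = 0 := by
    have hchain := (hΩ_apply fun _ => (v, 0)).hasFDerivAt.comp (f := fun k' => (u, k')) k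
      (hasFDerivAt_prodMk_right u k)
    exact congrArg (fun l => l w) (hchain.unique
      ((hasFDerivAt_const (Ω (u, k) fun _ => (v, 0)) k).congr_of_eventuallyEq (hleft v)))
  have hexpand := (extDeriv_apply hΩ ![(v, 0), (0, w)]).symm.trans
    (congrArg (fun l => l ![(v, 0), (0, w)]) hclosed)
  have hremove₀ : (0 : Fin 2).removeNth ![((v, 0) : E × E'), (0, w)] = fun _ => (0, w) := by
    ext i <;> fin_cases i <;> rfl
  have hremove₁ : (1 : Fin 2).removeNth ![((v, 0) : E × E'), (0, w)] = fun _ => (v, 0) := by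
    ext i <;> fin_cases i <;> rfl
  simpa [Fin.sum_univ_two, hremove₀, hremove₁, hvert] using hexpand

end ProdDerivative

theorem isLocallyConstant_of_hasFDerivAt_zero [I.Boundaryless] {f : M → ℝ}
    (hf : ∀ x₀ : M, ∀ u ∈ (extChartAt I x₀).target,
      HasFDerivAt (f ∘ (extChartAt I x₀).symm) (0 : E →L[ℝ] ℝ) u) :
    IsLocallyConstant f := by
  rw [IsLocallyConstant.iff_eventually_eq]
  intro x₀
  obtain ⟨ε, hε, hball⟩ := Metric.isOpen_iff.1 (isOpen_extChartAt_target (I := I) x₀) _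
    (mem_extChartAt_target x₀)
  have hconst : ∀ u ∈ Metric.ball (extChartAt I x₀ x₀) ε,
      f ((extChartAt I x₀).symm u) = f ((extChartAt I x₀).symm (extChartAt I x₀ x₀)) := fun u hu =>
    Metric.isOpen_ball.is_const_of_fderiv_eq_zero (𝕜 := ℝ)
      (f := f ∘ (extChartAt I x₀).symm) (convex_ball _ _).isPreconnected
      (fun u hu => (hf x₀ u (hball hu)).differentiableAt.differentiableWithinAt)
      (fun u hu => (hf x₀ u (hball hu)).fderiv) hu (Metric.mem_ball_self hε)
  filter_upwards [extChartAt_source_mem_nhds (I := I) x₀,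
    (continuousAt_extChartAt x₀).preimage_mem_nhds
      (Metric.ball_mem_nhds (extChartAt I x₀ x₀) hε)] with x hx hxball
  simpa only [(extChartAt I x₀).left_inv hx, extChartAt_to_inv] using hconst _ hxball

theorem mem_extChartAt_prod_target {x₀ : M} {y₀ : M'} {k : E'} {u : E}
    (hu : u ∈ (extChartAt I x₀).target) (hk : k ∈ (extChartAt I' y₀).target) :
    (u, k) ∈ (extChartAt (I.prod I') (x₀, y₀)).target := by
  rw [extChartAt_prod]
  exact ⟨hu, hk⟩

variable [I.Boundaryless] [I'.Boundaryless] [IsManifold I ∞ M] [IsManifold I' ∞ M']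

theorem pullback_id (α : DForm I M p) : pullback ContMDiffMap.id α = α := by
  refine Subtype.ext (funext fun x => ContinuousAlternatingMap.ext fun v => ?_)
  exact congrArg (fun l : E →L[ℝ] E => (α.1 x : E [⋀^Fin p]→L[ℝ] ℝ) fun i => l (v i)) mfderiv_id

theorem pullback_const (y : M') (α : DForm I' M' (p + 1)) :
    pullback (ContMDiffMap.const y : C^∞⟮I, M; I', M'⟯) α = 0 := by
  refine Subtype.ext (funext fun x => ContinuousAlternatingMap.ext fun v => ?_)
  exact (α.1 y).map_coord_zero 0 (congrArg (fun l : E →L[ℝ] E' => l (v 0)) mfderiv_const)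

theorem pullback_sliceLeft_apply (α : DForm (I.prod I') (M × M') 1) (x : M) (y : M') (v : E) :
    (pullback (sliceLeft y) α).1 x (fun _ => v) = α.1 (x, y) (fun _ => (v, 0)) :=
  congrArg (fun l : E →L[ℝ] E × E' => (α.1 (x, y) : (E × E') [⋀^Fin 1]→L[ℝ] ℝ) fun _ => l v)
    mfderiv_prod_left

theorem pullback_sliceRight_apply (α : DForm (I.prod I') (M × M') 1) (x : M) (y : M') (w : E') :
    (pullback (sliceRight x) α).1 y (fun _ => w) = α.1 (x, y) (fun _ => (0, w)) :=
  congrArg (fun l : E' →L[ℝ] E × E' => (α.1 (x, y) : (E × E') [⋀^Fin 1]→L[ℝ] ℝ) fun _ => l w)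
    mfderiv_prod_right

theorem oneForm_ext_prod {α β : DForm (I.prod I') (M × M') 1}
    (hleft : ∀ y : M', pullback (sliceLeft (I := I) y) α = pullback (sliceLeft y) β)
    (hright : ∀ x : M, pullback (sliceRight (I' := I') x) α = pullback (sliceRight x) β) :
    α = β := by
  refine Subtype.ext (funext fun ⟨x, y⟩ => ContinuousAlternatingMap.ext fun v => ?_)
  have hsplit (γ : DForm (I.prod I') (M × M') 1) : γ.1 (x, y) v =
      (pullback (sliceLeft y) γ).1 x (fun _ => (v 0).1) +
        (pullback (sliceRight x) γ).1 y (fun _ => (v 0).2) := by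
    let γ₀ : E × E' →L[ℝ] ℝ := (ContinuousAlternatingMap.ofSubsingleton ℝ (E × E') ℝ 0).symm
      (γ.1 (x, y) : (E × E') [⋀^Fin 1]→L[ℝ] ℝ)
    have hv : v = fun _ => v 0 := funext fun i => congrArg v (Subsingleton.elim i 0)
    rw [pullback_sliceLeft_apply, pullback_sliceRight_apply, hv]
    exact (congrArg γ₀ (Prod.fst_add_snd (v 0 : E × E')).symm).trans (map_add γ₀ _ _)
  rw [hsplit, hsplit, hleft, hright]

theorem localRep_self (α : DForm I M p) (x₀ : M) :
    localRep α.1 x₀ (extChartAt I x₀ x₀) = α.1 x₀ := by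
  have hid : (extChartAt I x₀).symm ∘ extChartAt I x₀ =ᶠ[𝓝 x₀] id := by
    filter_upwards [extChartAt_source_mem_nhds (I := I) x₀] with x hx
    exact (extChartAt I x₀).left_inv hx
  have hcomp := rawPullback_comp α.1
    ((contMDiffAt_symm (I := I) (mem_extChartAt_target x₀)).mdifferentiableAt (by simp))
    (mdifferentiableAt_extChartAt (I := I) (mem_chart_source B x₀))
  rw [rawPullback_congr α.1 hid] at hcomp
  refine (ContinuousAlternatingMap.ext fun v => ?_).trans
    (hcomp.symm.trans (congrFun (congrArg Subtype.val (pullback_id α)) x₀))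
  exact congrArg (fun l : E →L[ℝ] E =>
    (localRep α.1 x₀ (extChartAt I x₀ x₀) : E [⋀^Fin p]→L[ℝ] ℝ) fun i => l (v i))
      (mfderiv_extChartAt_self (I := I) (x := x₀)).symm

theorem localRep_pullback (f : C^∞⟮I, M; I', M'⟯) (α : DForm I' M' p) {x₀ : M} {y₀ : M'}
    {Φ : E → E'} {Φ' : E →L[ℝ] E'} {u : E} (hu : u ∈ (extChartAt I x₀).target)
    (hΦu : Φ u ∈ (extChartAt I' y₀).target) (hΦ : HasFDerivAt Φ Φ' u)
    (hcomm : (extChartAt I' y₀).symm ∘ Φ = f ∘ (extChartAt I x₀).symm) :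
    localRep (pullback f α).1 x₀ u = (localRep α.1 y₀ (Φ u)).compContinuousLinearMap Φ' := by
  have hupper := rawPullback_comp (I := 𝓘(ℝ, E)) α.1 (f.contMDiff.mdifferentiableAt (by simp))
    ((contMDiffAt_symm hu).mdifferentiableAt (by simp))
  have hlower := rawPullback_comp (I := 𝓘(ℝ, E)) α.1
    ((contMDiffAt_symm hΦu).mdifferentiableAt (by simp)) hΦ.differentiableAt.mdifferentiableAt
  refine hupper.symm.trans ?_
  rw [← hcomm, hlower]
  refine ContinuousAlternatingMap.ext fun v => ?_
  exact congrArg (fun l : E →L[ℝ] E' =>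
    (localRep α.1 y₀ (Φ u) : E' [⋀^Fin p]→L[ℝ] ℝ) fun i => l (v i))
      (mfderiv_eq_fderiv.trans hΦ.fderiv)

section ProdChart

variable (α : DForm (I.prod I') (M × M') 1) {x₀ : M} {y₀ : M'} {k : E'} {u : E}

theorem localRep_prod_inl (hu : u ∈ (extChartAt I x₀).target)
    (hk : k ∈ (extChartAt I' y₀).target) (v : E) :
    localRep α.1 (x₀, y₀) (u, k) (fun _ => (v, 0)) =
      localRep (pullback (sliceLeft ((extChartAt I' y₀).symm k)) α).1 x₀ u (fun _ => v) := by
  rw [localRep_pullback (sliceLeft _) α hu (mem_extChartAt_prod_target hu hk)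
    (hasFDerivAt_prodMk_left u k) (by rw [extChartAt_prod]; rfl)]
  rfl

theorem localRep_prod_inr (hu : u ∈ (extChartAt I x₀).target)
    (hk : k ∈ (extChartAt I' y₀).target) (w : E') :
    localRep α.1 (x₀, y₀) (u, k) (fun _ => (0, w)) =
      localRep (pullback (sliceRight ((extChartAt I x₀).symm u)) α).1 y₀ k (fun _ => w) := by
  rw [localRep_pullback (sliceRight _) α hk (mem_extChartAt_prod_target hu hk)
    (hasFDerivAt_prodMk_right u k) (by rw [extChartAt_prod]; rfl)]
  rfl

end ProdChart

theorem isLocallyConstant_pullback_sliceRight {α : DForm (I.prod I') (M × M') 1}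
    {β : DForm I M 1} (hclosed : dR α = 0) (hleft : ∀ y : M', pullback (sliceLeft y) α = β)
    (y : M') (w : E') :
    IsLocallyConstant fun x : M => (pullback (sliceRight (I' := I') x) α).1 y (fun _ => w) := by
  refine isLocallyConstant_of_hasFDerivAt_zero (I := I) fun x₀ u hu => ?_
  set k := extChartAt I' y y
  have hk : k ∈ (extChartAt I' y).target := mem_extChartAt_target y
  have hsymm := contMDiffAt_symm (mem_extChartAt_prod_target hu hk)
  have hrep : HasFDerivAt (fun u' => localRep α.1 (x₀, y) (u', k) (fun _ => (0, w)))
      (0 : E →L[ℝ] ℝ) u := by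
    refine hasFDerivAt_inr_component_zero
      ((DForm.smooth α).contDiffAt_vecPullback hsymm |>.differentiableAt (by simp)) ?_
      (fun v => ?_) w
    · refine ((DForm.smooth α).extDeriv_vecPullback hsymm).trans ?_
      rw [show rawExtDeriv α.1 = 0 from congrArg Subtype.val hclosed]
      rfl
    · filter_upwards [(isOpen_extChartAt_target y).mem_nhds hk] with k' hk'
      refine (localRep_prod_inl α hu hk' v).trans
        (Eq.trans ?_ (localRep_prod_inl α hu hk v).symm)
      rw [hleft, hleft]
  refine hrep.congr_of_eventuallyEq ?_
  filter_upwards [(isOpen_extChartAt_target x₀).mem_nhds hu] with u' hu'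
  refine Eq.trans ?_ (localRep_prod_inr α hu' hk w).symm
  rw [localRep_self]
  rfl

end Forms

section MultiplicativeForms

variable {V : Type*} [NormedAddCommGroup V] [NormedSpace ℝ V]
  {G : Type*} [TopologicalSpace G] [ChartedSpace V G] [Group G] [LieGroup 𝓘(ℝ, V) ∞ G]
  {E : Type*} [NormedAddCommGroup E] [NormedSpace ℝ E] {B : Type*} [TopologicalSpace B]
  {I : ModelWithCorners ℝ E B} {M : Type*} [TopologicalSpace M] [ChartedSpace B M]
  [I.Boundaryless] [IsManifold I ∞ M] {p : ℕ}

/-- A form `θ` on `G` is multiplicative if `mul^* θ = pr₁^* θ + pr₂^* θ` on `G × G`. Equivalently,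
`f ↦ f^* θ` is a homomorphism on the groups of smooth maps to `G`. -/
def IsMultiplicative (θ : DForm 𝓘(ℝ, V) G p) : Prop :=
  pullback
    (ContMDiffMap.fst * ContMDiffMap.snd : C^∞⟮𝓘(ℝ, V).prod 𝓘(ℝ, V), G × G; 𝓘(ℝ, V), G⟯) θ =
      pullback ContMDiffMap.fst θ + pullback ContMDiffMap.snd θ

theorem mfderiv_mul_one_one (a b : V) :
    (mfderiv (𝓘(ℝ, V).prod 𝓘(ℝ, V)) 𝓘(ℝ, V) (fun x : G × G => x.1 * x.2) (1, 1) :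
      V × V →L[ℝ] V) (a, b) = a + b := by
  have hmul : MDifferentiableAt (𝓘(ℝ, V).prod 𝓘(ℝ, V)) 𝓘(ℝ, V) (fun x : G × G => x.1 * x.2)
      (1, 1) := (contMDiff_mul 𝓘(ℝ, V) ∞).mdifferentiable (by simp) _
  let D (f : G → G) : V →L[ℝ] V := mfderiv 𝓘(ℝ, V) 𝓘(ℝ, V) f 1
  have hleft : D (· * 1) = .id ℝ V := (congrArg D (funext mul_one)).trans mfderiv_id
  have hright : D (1 * ·) = .id ℝ V := (congrArg D (funext one_mul)).trans mfderiv_id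
  exact (mfderiv_prod_eq_add_apply hmul (v := ((a, b) : V × V))).trans
    (congrArg₂ (fun l l' : V →L[ℝ] V => l a + l' b) hleft hright)

namespace IsMultiplicative

section

variable {θ : DForm 𝓘(ℝ, V) G p}

theorem pullback_mul (hθ : IsMultiplicative θ) (f g : C^∞⟮I, M; 𝓘(ℝ, V), G⟯) :
    pullback (f * g) θ = pullback f θ + pullback g θ := by
  have := congrArg (pullback (f.prodMk g)) hθ
  simp only [map_add, pullback_comp] at this
  exact this

theorem pullback_one (hθ : IsMultiplicative θ) :
    pullback (1 : C^∞⟮I, M; 𝓘(ℝ, V), G⟯) θ = 0 := by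
  simpa only [mul_one, left_eq_add] using hθ.pullback_mul (1 : C^∞⟮I, M; 𝓘(ℝ, V), G⟯) 1

theorem pullback_inv (hθ : IsMultiplicative θ) (f : C^∞⟮I, M; 𝓘(ℝ, V), G⟯) :
    pullback f⁻¹ θ = -pullback f θ := by
  refine eq_neg_of_add_eq_zero_left (G := DForm I M p) ?_
  rw [← hθ.pullback_mul, inv_mul_cancel, hθ.pullback_one]

theorem dR (hθ : IsMultiplicative θ) : IsMultiplicative (dR θ) := by
  simpa only [IsMultiplicative, map_add, dR_pullback] using congrArg LieTwo.dR hθ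

end

theorem pullback_mul_left {θ : DForm 𝓘(ℝ, V) G (p + 1)} (hθ : IsMultiplicative θ) (g : G) :
    pullback (ContMDiffMap.const g * ContMDiffMap.id) θ = θ := by
  rw [hθ.pullback_mul, pullback_const, pullback_id, zero_add]

/-- On tangent vectors at `(1, 1)` the first of which is `(v₀, 0)` and the others `(0, vᵢ)`, both
projections contribute `0`. -/
theorem apply_one_eq_zero {η : DForm 𝓘(ℝ, V) G (p + 2)} (hη : IsMultiplicative η) :
    η.1 1 = 0 := by
  refine ContinuousAlternatingMap.ext fun (v : Fin (p + 2) → V) => ?_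
  let z : Fin (p + 2) → V × V := Fin.cons (v 0, 0) fun i => (0, v i.succ)
  have hz : ∀ i, (mfderiv (𝓘(ℝ, V).prod 𝓘(ℝ, V)) 𝓘(ℝ, V) (fun x : G × G => x.1 * x.2) (1, 1) :
      V × V →L[ℝ] V) (z i) = v i := by
    refine Fin.cases ?_ fun i => ?_
    · exact (mfderiv_mul_one_one _ _).trans (add_zero _)
    · exact (mfderiv_mul_one_one _ _).trans (zero_add _)
  have hmul := congrArg (fun α : DForm (𝓘(ℝ, V).prod 𝓘(ℝ, V)) (G × G) (p + 2) =>
    (α.1 (1, 1) : (V × V) [⋀^Fin (p + 2)]→L[ℝ] ℝ) z) hη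
  have hfst : (pullback (ContMDiffMap.fst : C^∞⟮𝓘(ℝ, V).prod 𝓘(ℝ, V), G × G; 𝓘(ℝ, V), G⟯)
      η).1 (1, 1) z = 0 :=
    (η.1 1).map_coord_zero 1 (congrArg (fun l : V × V →L[ℝ] V => l (z 1)) mfderiv_fst)
  have hsnd : (pullback (ContMDiffMap.snd : C^∞⟮𝓘(ℝ, V).prod 𝓘(ℝ, V), G × G; 𝓘(ℝ, V), G⟯)
      η).1 (1, 1) z = 0 :=
    (η.1 1).map_coord_zero 0 (congrArg (fun l : V × V →L[ℝ] V => l (z 0)) mfderiv_snd)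
  have hpoint : ∀ x : G, x = 1 → (η.1 x : V [⋀^Fin (p + 2)]→L[ℝ] ℝ) v = η.1 1 v := by
    rintro _ rfl
    rfl
  calc (η.1 1 : V [⋀^Fin (p + 2)]→L[ℝ] ℝ) v
      = (η.1 (1 * 1) : V [⋀^Fin (p + 2)]→L[ℝ] ℝ) v := (hpoint _ (mul_one 1)).symm
    _ = _ := congrArg (η.1 (1 * 1) : V [⋀^Fin (p + 2)]→L[ℝ] ℝ) (funext hz).symm
    _ = _ := hmul
    _ = 0 := (congrArg₂ (· + ·) hfst hsnd).trans (add_zero 0)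

theorem eq_zero {η : DForm 𝓘(ℝ, V) G (p + 2)} (hη : IsMultiplicative η) : η = 0 := by
  refine Subtype.ext (funext fun g => ?_)
  have hone : ∀ x : G, x = 1 → η.1 x = 0 := by
    rintro _ rfl
    exact hη.apply_one_eq_zero
  rw [← hη.pullback_mul_left g⁻¹]
  refine ContinuousAlternatingMap.ext fun v => ?_
  exact DFunLike.congr_fun (hone (g⁻¹ * g) (inv_mul_cancel g)) _

theorem dR_eq_zero {θ : DForm 𝓘(ℝ, V) G (p + 1)} (hθ : IsMultiplicative θ) : LieTwo.dR θ = 0 :=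
  hθ.dR.eq_zero

end IsMultiplicative

theorem isMultiplicative_of_pullback_mul {θ : DForm 𝓘(ℝ, V) G 1}
    (hleft : ∀ g : G, pullback (ContMDiffMap.const g * ContMDiffMap.id) θ = θ)
    (hright : ∀ g : G, pullback (ContMDiffMap.id * ContMDiffMap.const g) θ = θ) :
    IsMultiplicative θ := by
  refine oneForm_ext_prod (fun g => ?_) fun g => ?_
  · rw [map_add]
    simp only [pullback_comp]
    exact (hright g).trans ((congrArg₂ (· + ·) (pullback_id θ) (pullback_const g θ)).trans
      (add_zero θ)).symm
  · rw [map_add]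
    simp only [pullback_comp]
    exact (hleft g).trans ((congrArg₂ (· + ·) (pullback_const g θ) (pullback_id θ)).trans
      (zero_add θ)).symm

end MultiplicativeForms

section LeftInvariantForm

open LieCrossedModule (leftInvariantForm)

variable {V : Type*} [NormedAddCommGroup V] [NormedSpace ℝ V]
  {G : Type*} [TopologicalSpace G] [ChartedSpace V G] [Group G] [LieGroup 𝓘(ℝ, V) ∞ G]

theorem localRep_leftInvariantForm (ξ : GroupLieAlgebra 𝓘(ℝ, V) G →L[ℝ] ℝ) (x₀ : G) {z : V}
    (hz : z ∈ (extChartAt 𝓘(ℝ, V) x₀).target) :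
    localRep (leftInvariantForm V G ξ) x₀ z =
      ContinuousAlternatingMap.ofSubsingleton ℝ V ℝ (0 : Fin 1)
        ((ξ : V →L[ℝ] ℝ).comp (fderiv ℝ (fun z' => extChartAt 𝓘(ℝ, V) (1 : G)
          (((extChartAt 𝓘(ℝ, V) x₀).symm z)⁻¹ * (extChartAt 𝓘(ℝ, V) x₀).symm z')) z)) := by
  set φ := (extChartAt 𝓘(ℝ, V) x₀).symm
  have hφ : MDifferentiableAt 𝓘(ℝ, V) 𝓘(ℝ, V) φ z :=
    (contMDiffAt_symm hz).mdifferentiableAt (by simp)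
  have hmul : MDifferentiable 𝓘(ℝ, V) 𝓘(ℝ, V) fun x : G => (φ z)⁻¹ * x :=
    (contMDiff_mul_left (I := 𝓘(ℝ, V)) (n := ∞)).mdifferentiable (by simp)
  refine ContinuousAlternatingMap.ext fun v => congrArg (ξ : V →L[ℝ] ℝ) ?_
  have hchart := mfderiv_comp_apply_of_eq (I' := 𝓘(ℝ, V)) z (f := fun z' => (φ z)⁻¹ * φ z')
    (g := extChartAt 𝓘(ℝ, V) (1 : G)) (mdifferentiableAt_extChartAt (mem_chart_source V _))
    ((hmul _).comp z hφ) (inv_mul_cancel _) (v 0)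
  refine (mfderiv_comp_apply z (hmul _) hφ (v 0)).symm.trans (Eq.symm ?_)
  exact (congrArg (fun l : V →L[ℝ] V => l (v 0)) mfderiv_eq_fderiv.symm).trans (hchart.trans
    (congrArg (fun l : V →L[ℝ] V => l _) (mfderiv_extChartAt_self (I := 𝓘(ℝ, V)) (x := (1 : G)))))

theorem isSmoothForm_leftInvariantForm (ξ : GroupLieAlgebra 𝓘(ℝ, V) G →L[ℝ] ℝ) :
    IsSmoothForm (leftInvariantForm V G ξ) := by
  intro x₀ y hy
  set φ := (extChartAt 𝓘(ℝ, V) x₀).symm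
  set ψ := extChartAt 𝓘(ℝ, V) (1 : G)
  have hquot : ContDiffAt ℝ ∞ (Function.uncurry fun z z' => ψ ((φ z)⁻¹ * φ z')) (y, y) := by
    rw [← contMDiffAt_iff_contDiffAt]
    have hfst : ContMDiffAt 𝓘(ℝ, V × V) 𝓘(ℝ, V) ∞ (fun z : V × V => φ z.1) (y, y) :=
      (contMDiffAt_symm hy).comp (y, y) contDiff_fst.contMDiff.contMDiffAt
    have hsnd : ContMDiffAt 𝓘(ℝ, V × V) 𝓘(ℝ, V) ∞ (fun z : V × V => φ z.2) (y, y) :=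
      (contMDiffAt_symm hy).comp (y, y) contDiff_snd.contMDiff.contMDiffAt
    exact contMDiffAt_extChartAt.comp_of_eq (hfst.inv.mul hsnd) (inv_mul_cancel _)
  have hderiv : ContDiffAt ℝ ∞ (fun z => fderiv ℝ (fun z' => ψ ((φ z)⁻¹ * φ z')) z) y :=
    ContDiffAt.fderiv (f := fun z z' => ψ ((φ z)⁻¹ * φ z')) hquot contDiffAt_id (by simp)
  have hform := (ContinuousAlternatingMap.ofSubsingletonLIE (𝕜 := ℝ) (E := V) (F := ℝ)
    (0 : Fin 1)).contDiff.contDiffAt.comp y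
      ((contDiffAt_const (F := V →L[ℝ] ℝ) (c := ξ)).clm_comp hderiv)
  refine (hform.congr_of_eventuallyEq ?_).contDiffWithinAt
  filter_upwards [(isOpen_extChartAt_target x₀).mem_nhds hy] with z hz
  exact localRep_leftInvariantForm ξ x₀ hz

/-- The left invariant form `ξ^L` as a smooth form, depending linearly on `ξ`. -/
def leftInvariantDForm : (GroupLieAlgebra 𝓘(ℝ, V) G →L[ℝ] ℝ) →ₗ[ℝ] DForm 𝓘(ℝ, V) G 1 where
  toFun ξ := ⟨leftInvariantForm V G ξ, isSmoothForm_leftInvariantForm ξ⟩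
  map_add' _ _ := rfl
  map_smul' _ _ := rfl

theorem pullback_mul_left_leftInvariantDForm (ξ : GroupLieAlgebra 𝓘(ℝ, V) G →L[ℝ] ℝ) (g : G) :
    pullback (ContMDiffMap.const g * ContMDiffMap.id) (leftInvariantDForm ξ) =
      leftInvariantDForm ξ := by
  have hmul (a : G) : MDifferentiable 𝓘(ℝ, V) 𝓘(ℝ, V) fun x : G => a * x :=
    (contMDiff_mul_left (I := 𝓘(ℝ, V)) (n := ∞)).mdifferentiable (by simp)
  refine Subtype.ext (funext fun x => ContinuousAlternatingMap.ext fun v =>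
    congrArg (ξ : V →L[ℝ] ℝ) ?_)
  refine (mfderiv_comp_apply x (hmul (g * x)⁻¹ (g * x)) (hmul g x) (v 0)).symm.trans ?_
  have htrans : (fun y => (g * x)⁻¹ * y) ∘ (fun y => g * y) = fun y => x⁻¹ * y := by
    funext y
    simp only [Function.comp_apply]
    group
  exact congrArg (fun f : G → G => (mfderiv 𝓘(ℝ, V) 𝓘(ℝ, V) f x : V →L[ℝ] V) (v 0)) htrans

end LeftInvariantForm

namespace LieCrossedModule

variable {V : Type*} [NormedAddCommGroup V] [NormedSpace ℝ V]
  {W : Type*} [NormedAddCommGroup W] [NormedSpace ℝ W]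
  {G : Type*} [TopologicalSpace G] [ChartedSpace V G] [Group G]
  {H : Type*} [TopologicalSpace H] [ChartedSpace W H] [Group H]
  (X : LieCrossedModule V W G H)

/-- The action `(g, h) ↦ g^h` as a smooth map. -/
def actMap : C^∞⟮𝓘(ℝ, V).prod 𝓘(ℝ, W), G × H; 𝓘(ℝ, V), G⟯ :=
  ⟨fun x => X.act x.1 x.2, X.contMDiff_act⟩

/-- The boundary homomorphism as a smooth map. -/
def bdMap : C^∞⟮𝓘(ℝ, V), G; 𝓘(ℝ, W), H⟯ :=
  ⟨X.bd, X.contMDiff_bd⟩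

/-- The orbit map `h ↦ g^h` of `g`. -/
def orbitMap (g : G) : C^∞⟮𝓘(ℝ, W), H; 𝓘(ℝ, V), G⟯ :=
  X.actMap.comp (sliceRight g)

theorem orbitMap_one : X.orbitMap 1 = 1 :=
  ContMDiffMap.ext X.one_act

theorem orbitMap_eq_comp_mul_left [LieGroup 𝓘(ℝ, W) ∞ H] (g : G) (k : H) :
    X.orbitMap g = (X.orbitMap (X.act g k)).comp (ContMDiffMap.const k⁻¹ * ContMDiffMap.id) :=
  ContMDiffMap.ext fun h => by
    change X.act g h = X.act (X.act g k) (k⁻¹ * h)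
    rw [← X.act_mul, mul_inv_cancel_left]

variable [LieGroup 𝓘(ℝ, V) ∞ G]

theorem orbitMap_mul (g g' : G) : X.orbitMap (g * g') = X.orbitMap g * X.orbitMap g' :=
  ContMDiffMap.ext (X.mul_act g g')

theorem orbitMap_comp_bdMap (g : G) :
    (X.orbitMap g).comp X.bdMap = ContMDiffMap.id⁻¹ * ContMDiffMap.const g * ContMDiffMap.id :=
  ContMDiffMap.ext (X.act_bd g)

theorem mul_const_eq_comp_actMap (g : G) :
    ContMDiffMap.id * ContMDiffMap.const g = (ContMDiffMap.const g * ContMDiffMap.id :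
      C^∞⟮𝓘(ℝ, V), G; 𝓘(ℝ, V), G⟯).comp (X.actMap.comp (sliceLeft (X.bd g))) :=
  ContMDiffMap.ext fun x => by
    change x * g = g * X.act x (X.bd g)
    rw [X.act_bd]
    group

theorem pullback_act_leftInvariantDForm (ξ : X.invDual) (h : H) :
    pullback (X.actMap.comp (sliceLeft h)) (leftInvariantDForm (V := V) ξ.1) =
      leftInvariantDForm (V := V) ξ.1 := by
  have hmul (a : G) : MDifferentiable 𝓘(ℝ, V) 𝓘(ℝ, V) fun x : G => a * x :=
    (contMDiff_mul_left (I := 𝓘(ℝ, V)) (n := ∞)).mdifferentiable (by simp)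
  have hact : MDifferentiable 𝓘(ℝ, V) 𝓘(ℝ, V) fun x : G => X.act x h :=
    (X.actMap.comp (sliceLeft h)).contMDiff.mdifferentiable (by simp)
  refine Subtype.ext (funext fun g => ContinuousAlternatingMap.ext fun v => ?_)
  have htrans : (fun x => (X.act g h)⁻¹ * x) ∘ (fun x => X.act x h) =
      (fun x => X.act x h) ∘ fun x => g⁻¹ * x := by
    funext x
    simp only [Function.comp_apply, X.mul_act, X.inv_act]
  let D (f : G → G) : V →L[ℝ] V := mfderiv 𝓘(ℝ, V) 𝓘(ℝ, V) f g
  let ξ' : V →L[ℝ] ℝ := ξ.1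
  calc ξ' _ = ξ' (D ((fun x => (X.act g h)⁻¹ * x) ∘ fun x => X.act x h) (v 0)) :=
        congrArg ξ' (mfderiv_comp_apply g (hmul _ _) (hact g) (v 0)).symm
    _ = ξ' (D ((fun x => X.act x h) ∘ fun x => g⁻¹ * x) (v 0)) := by rw [htrans]
    _ = ξ' _ := congrArg ξ' (mfderiv_comp_apply_of_eq (y := (1 : G)) g (hact 1) (hmul g⁻¹ g)
        (inv_mul_cancel g) (v 0))
    _ = _ := ξ.2.2 h _

theorem isMultiplicative_leftInvariantDForm (ξ : X.invDual) :
    IsMultiplicative (leftInvariantDForm (V := V) ξ.1) := by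
  refine isMultiplicative_of_pullback_mul (pullback_mul_left_leftInvariantDForm _) fun g => ?_
  rw [X.mul_const_eq_comp_actMap, ← pullback_comp, pullback_mul_left_leftInvariantDForm,
    X.pullback_act_leftInvariantDForm]

section Orbit

variable [LieGroup 𝓘(ℝ, W) ∞ H] {θ : DForm 𝓘(ℝ, V) G 1}

theorem isLocallyConstant_pullback_orbitMap (hclosed : dR θ = 0)
    (hact : ∀ h : H, pullback (X.actMap.comp (sliceLeft h)) θ = θ) (h : H) (w : W) :
    IsLocallyConstant fun g : G => (pullback (X.orbitMap g) θ).1 h (fun _ => w) := by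
  have hclosed' : dR (pullback X.actMap θ) = 0 := by rw [dR_pullback, hclosed, map_zero]
  have hleft (k : H) : pullback (sliceLeft k) (pullback X.actMap θ) = θ :=
    (pullback_comp _ _ _).trans (hact k)
  have hright (g : G) : pullback (sliceRight g) (pullback X.actMap θ) =
      pullback (X.orbitMap g) θ := pullback_comp _ _ _
  simpa only [hright] using isLocallyConstant_pullback_sliceRight hclosed' hleft h w

variable {X}

/-- The homomorphism `g ↦ (orbit_g^* θ)_h(w)` defined by a multiplicative form `θ`. -/
def orbitHom (hθ : IsMultiplicative θ) (h : H) (w : W) : G →* Multiplicative ℝ where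
  toFun g := .ofAdd ((pullback (X.orbitMap g) θ).1 h (fun _ => w))
  map_one' := by
    rw [X.orbitMap_one, hθ.pullback_one]
    rfl
  map_mul' g g' := by
    rw [X.orbitMap_mul, hθ.pullback_mul]
    rfl

theorem orbitHom_apply_of_mem_connectedComponent (hθ : IsMultiplicative θ)
    (hact : ∀ h : H, pullback (X.actMap.comp (sliceLeft h)) θ = θ) (h : H) (w : W) {g : G}
    (hg : g ∈ connectedComponent (1 : G)) : orbitHom (X := X) hθ h w g = 1 :=
  (congrArg Multiplicative.ofAdd ((X.isLocallyConstant_pullback_orbitMap hθ.dR_eq_zero hact h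
    w).apply_eq_of_isPreconnected isPreconnected_connectedComponent hg
      mem_connectedComponent)).trans (map_one (orbitHom (X := X) hθ h w))

theorem pullback_bdMap_pullback_orbitMap (hθ : IsMultiplicative θ) (g : G) :
    pullback X.bdMap (pullback (X.orbitMap g) θ) = 0 := by
  rw [pullback_comp, X.orbitMap_comp_bdMap, hθ.pullback_mul, hθ.pullback_mul, hθ.pullback_inv,
    pullback_const, add_zero]
  exact neg_add_cancel (G := DForm 𝓘(ℝ, V) G 1) _

theorem pullback_orbitMap_apply_one_of_surjective (hθ : IsMultiplicative θ)
    (hsurj : Function.Surjective (mfderiv 𝓘(ℝ, V) 𝓘(ℝ, W) X.bd 1)) (g : G) (w : W) :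
    (pullback (X.orbitMap g) θ).1 1 (fun _ => w) = 0 := by
  obtain ⟨v, rfl⟩ := hsurj w
  have hone : ∀ k : H, k = 1 → ∀ u : W, (pullback (X.orbitMap g) θ).1 1 (fun _ => u) =
      (pullback (X.orbitMap g) θ).1 k (fun _ => u) := by
    rintro _ rfl u
    rfl
  exact (hone _ (map_one X.bd) _).trans
    (congrArg (fun η : DForm 𝓘(ℝ, V) G 1 => η.1 1 (fun _ => v))
      (pullback_bdMap_pullback_orbitMap hθ g))

theorem pullback_orbitMap_eq_zero
    (hone : ∀ (g : G) (w : W), (pullback (X.orbitMap g) θ).1 1 (fun _ => w) = 0) (g : G) :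
    pullback (X.orbitMap g) θ = 0 := by
  refine Subtype.ext (funext fun k => ContinuousAlternatingMap.ext fun v => ?_)
  have hpoint : ∀ h : H, h = 1 → ∀ w : W,
      (pullback (X.orbitMap (X.act g k)) θ).1 h (fun _ => w) = 0 := by
    rintro _ rfl w
    exact hone _ w
  have hv : v = fun _ => v 0 := funext fun i => congrArg v (Subsingleton.elim i 0)
  rw [X.orbitMap_eq_comp_mul_left g k, ← pullback_comp, hv]
  exact hpoint (k⁻¹ * k) (inv_mul_cancel k) _

theorem pullback_actMap_eq (hact : ∀ h : H, pullback (X.actMap.comp (sliceLeft h)) θ = θ)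
    (horbit : ∀ g : G, pullback (X.orbitMap g) θ = 0) :
    pullback X.actMap θ = pullback ContMDiffMap.fst θ := by
  refine oneForm_ext_prod (fun h => ?_) fun g => ?_
  · simp only [pullback_comp]
    exact (hact h).trans (pullback_id θ).symm
  · simp only [pullback_comp]
    exact (horbit g).trans (pullback_const g θ).symm

end Orbit

theorem pullback_actMap_leftInvariantDForm [LieGroup 𝓘(ℝ, W) ∞ H]
    (hX : (∀ χ : G →* Multiplicative ℝ, (∀ g ∈ connectedComponent (1 : G), χ g = 1) → χ = 1) ∨
      Function.Surjective (mfderiv 𝓘(ℝ, V) 𝓘(ℝ, W) X.bd 1)) (ξ : X.invDual) :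
    pullback X.actMap (leftInvariantDForm (V := V) ξ.1) =
      pullback ContMDiffMap.fst (leftInvariantDForm (V := V) ξ.1) := by
  have hθ := X.isMultiplicative_leftInvariantDForm ξ
  have hact := X.pullback_act_leftInvariantDForm ξ
  refine pullback_actMap_eq hact (pullback_orbitMap_eq_zero fun g w => ?_)
  rcases hX with hchar | hsurj
  · exact congrArg (fun χ : G →* Multiplicative ℝ => (χ g).toAdd) (hchar (orbitHom hθ 1 w)
      fun g' hg' => orbitHom_apply_of_mem_connectedComponent hθ hact 1 w hg')
  · exact pullback_orbitMap_apply_one_of_surjective hθ hsurj g w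

end LieCrossedModule

section SingleHom

open CategoryTheory

theorem exists_hom_single_of_d_eq_zero {R : Type*} [Ring R] {ι : Type*} [DecidableEq ι]
    {c : ComplexShape ι} {K : HomologicalComplex (ModuleCat.{u} R) c} {n : ι} {A : ModuleCat.{u} R}
    (φ : A ⟶ K.X n) (hφ : ∀ k, c.Rel n k → ∀ a : A, (K.d n k).hom (φ.hom a) = 0) :
    ∃ Φ : (HomologicalComplex.single (ModuleCat.{u} R) c n).obj A ⟶ K,
      ∀ a : A, (Φ.f n).hom ((HomologicalComplex.singleObjXSelf c n A).inv.hom a) = φ.hom a := by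
  refine ⟨HomologicalComplex.mkHomFromSingle φ fun k hk =>
    ModuleCat.hom_ext (LinearMap.ext (hφ k hk)), fun a => ?_⟩
  rw [← ModuleCat.comp_apply, HomologicalComplex.mkHomFromSingle_f, Iso.inv_hom_id_assoc]

end SingleHom

namespace LieCrossedModule

variable {V : Type*} [NormedAddCommGroup V] [NormedSpace ℝ V]
  {W : Type*} [NormedAddCommGroup W] [NormedSpace ℝ W]
  {G : Type*} [TopologicalSpace G] [ChartedSpace V G]
  {H : Type*} [TopologicalSpace H] [ChartedSpace W H]

section Tot

variable {n p q : ℕ}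

/-- The inclusion of `Ω^p(N_q)` into the total complex. -/
def totSingle (h : p + q = n) : Form V W G H p q →ₗ[ℝ] Tot V W G H n :=
  LinearMap.single ℝ (fun e : {e : ℕ × ℕ // e.1 + e.2 = n} => Form V W G H e.1.1 e.1.2)
    ⟨(p, q), h⟩

theorem totSingle_apply_self (h : p + q = n) (α : Form V W G H p q) :
    totSingle h α ⟨(p, q), h⟩ = α :=
  Pi.single_eq_same (M := fun e : {e : ℕ × ℕ // e.1 + e.2 = n} => Form V W G H e.1.1 e.1.2)
    ⟨(p, q), h⟩ α

theorem totSingle_apply_of_ne (h : p + q = n) (α : Form V W G H p q)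
    {e : {e : ℕ × ℕ // e.1 + e.2 = n}} (he : e.1 ≠ (p, q)) : totSingle h α e = 0 :=
  Pi.single_eq_of_ne (M := fun e : {e : ℕ × ℕ // e.1 + e.2 = n} => Form V W G H e.1.1 e.1.2)
    (i := ⟨(p, q), h⟩) (fun heq => he (congrArg Subtype.val heq)) α

variable [Group G] [LieGroup 𝓘(ℝ, V) ∞ G] [Group H] [LieGroup 𝓘(ℝ, W) ∞ H]

theorem totD_totSingle_eq_zero (X : LieCrossedModule V W G H) (h : p + q = n)
    {α : Form V W G H p q} (hd : dForm p q α = 0) (hdel : X.del p q α = 0) :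
    X.totD n (totSingle h α) = 0 := by
  have hdComp : ∀ p' q' (h' : p' + q' = n + 1), dComp n p' q' h' (totSingle h α) = 0 := by
    rintro (_ | p') q' h'
    · rfl
    · change dForm p' q' (totSingle h α ⟨(p', q'), by omega⟩) = 0
      by_cases heq : (p', q') = (p, q)
      · cases heq
        rw [totSingle_apply_self, hd]
      · rw [totSingle_apply_of_ne h α heq, map_zero]
  have hdelComp : ∀ p' q' (h' : p' + q' = n + 1), X.delComp n p' q' h' (totSingle h α) = 0 := by
    rintro p' (_ | q') h'
    · rfl
    · change X.del p' q' (totSingle h α ⟨(p', q'), by omega⟩) = 0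
      by_cases heq : (p', q') = (p, q)
      · cases heq
        rw [totSingle_apply_self, hdel]
      · rw [totSingle_apply_of_ne h α heq, map_zero]
  funext e
  exact (congrArg₂ (· + ·) (hdComp _ _ e.2) (hdelComp _ _ e.2)).trans (add_zero 0)

theorem totComplex_d_apply (X : LieCrossedModule V W G H) (n : ℕ) (α : Tot V W G H n) :
    (X.totComplex.d n (n + 1)).hom α = X.totD n α :=
  congrArg (fun f => f.hom α) (CochainComplex.of_d (fun n => ModuleCat.of ℝ (Tot V W G H n))
    (fun n => ModuleCat.ofHom (X.totD n)) n)

end Tot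

section TriForm

variable [Group G] [LieGroup 𝓘(ℝ, V) ∞ G] [Group H] [LieGroup 𝓘(ℝ, W) ∞ H]
  (X : LieCrossedModule V W G H) {q : ℕ} (a b c d : Fin (q + 1))

/-- The edge `a → b` of a simplex of the nerve, as a smooth map. -/
def edgeMap : C^∞⟮modelN V W q, N G H q; 𝓘(ℝ, W), H⟯ :=
  ⟨fun x => X.edgeOf x a b, X.contMDiff_edgeOf a b⟩

/-- The triangle `a, b, c` of a simplex of the nerve, as a smooth map. -/
def triMap : C^∞⟮modelN V W q, N G H q; 𝓘(ℝ, V), G⟯ :=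
  ⟨fun x => X.triOf x a b c, X.contMDiff_triOf a b c⟩

/-- The pullback `g_{abc}^* ξ^L` of a left invariant form along a triangle of the nerve. -/
def triForm : X.invDual →ₗ[ℝ] Form V W G H 1 q :=
  (pullback (p := 1) (X.triMap a b c)).comp (leftInvariantDForm.comp X.invDual.subtype)

theorem dForm_triForm (ξ : X.invDual) : dForm 1 q (X.triForm a b c ξ) = 0 := by
  refine (dR_pullback (X.triMap a b c) (leftInvariantDForm ξ.1)).trans ?_
  rw [(X.isMultiplicative_leftInvariantDForm ξ).dR_eq_zero, map_zero]
  rfl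

variable {a b c} in
theorem triMap_comp_face (i : Fin (q + 2)) (hab : a < b) (hbc : b < c) :
    (X.triMap a b c).comp (X.face i) =
      X.triMap (i.succAbove a) (i.succAbove b) (i.succAbove c) :=
  ContMDiffMap.ext fun x => congrArg (fun σ : X.Simplex q => σ.tri a b c hab hbc)
    ((X.simplexEquiv q).apply_symm_apply (Simplex.face X i (X.simplexEquiv (q + 1) x)))

variable {a b c} in
theorem coface_triForm (i : Fin (q + 2)) (hab : a < b) (hbc : b < c) (ξ : X.invDual) :
    X.coface 1 q i (X.triForm a b c ξ) =
      X.triForm (i.succAbove a) (i.succAbove b) (i.succAbove c) ξ := by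
  refine (pullback_comp (X.triMap a b c) (X.face i) (leftInvariantDForm ξ.1)).trans ?_
  rw [X.triMap_comp_face i hab hbc]
  rfl

theorem actMap_comp_triMap_mul_triMap :
    X.actMap.comp ((X.triMap a b c).prodMk (X.edgeMap c d)) * X.triMap a c d =
      X.triMap b c d * X.triMap a b d :=
  ContMDiffMap.ext fun x => X.triOf_mul x a b c d

variable {ξ : X.invDual} (hξ : pullback X.actMap (leftInvariantDForm (V := V) ξ.1) =
  pullback ContMDiffMap.fst (leftInvariantDForm (V := V) ξ.1))
include hξ

theorem triForm_add_triForm :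
    X.triForm a b c ξ + X.triForm a c d ξ = X.triForm b c d ξ + X.triForm a b d ξ := by
  have hθ := X.isMultiplicative_leftInvariantDForm ξ
  have hact : pullback (X.actMap.comp ((X.triMap a b c).prodMk (X.edgeMap c d)))
      (leftInvariantDForm (V := V) ξ.1) =
        pullback (X.triMap a b c) (leftInvariantDForm (V := V) ξ.1) := by
    rw [← pullback_comp, hξ, pullback_comp]
    rfl
  have htetra := congrArg (fun f => pullback f (leftInvariantDForm (V := V) ξ.1))
    (X.actMap_comp_triMap_mul_triMap a b c d)
  simp only [hθ.pullback_mul, hact] at htetra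
  exact htetra

theorem del_triForm : X.del 1 2 (X.triForm 0 1 2 ξ) = 0 := by
  have hface (i : Fin 4) : X.coface 1 2 i (X.triForm 0 1 2 ξ) =
      X.triForm (i.succAbove 0) (i.succAbove 1) (i.succAbove 2) ξ :=
    X.coface_triForm i (by decide) (by decide) ξ
  have hface₀ : X.coface 1 2 0 (X.triForm 0 1 2 ξ) = X.triForm (1 : Fin 4) 2 3 ξ := hface 0
  have hface₁ : X.coface 1 2 1 (X.triForm 0 1 2 ξ) = X.triForm (0 : Fin 4) 2 3 ξ := hface 1
  have hface₂ : X.coface 1 2 2 (X.triForm 0 1 2 ξ) = X.triForm (0 : Fin 4) 1 3 ξ := hface 2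
  have hface₃ : X.coface 1 2 3 (X.triForm 0 1 2 ξ) = X.triForm (0 : Fin 4) 1 2 ξ := hface 3
  rw [X.del_apply, Fin.sum_univ_four, hface₀, hface₁, hface₂, hface₃,
    eq_sub_of_add_eq (X.triForm_add_triForm (0 : Fin 4) 1 2 3 hξ)]
  simp only [Fin.val_zero, Fin.val_one, Fin.val_two, show ((3 : Fin 4) : ℕ) = 3 from rfl]
  module

end TriForm

section Cocycle

variable [Group G] [LieGroup 𝓘(ℝ, V) ∞ G] [Group H] [LieGroup 𝓘(ℝ, W) ∞ H]
  (X : LieCrossedModule V W G H)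

/-- The map `ξ ↦ I(ξ) = g_{012}^* ξ^L ∈ Ω^1(N_2)`, with values in the total complex. -/
def cocycle : X.invDual →ₗ[ℝ] Tot V W G H 3 :=
  (totSingle rfl).comp (X.triForm (0 : Fin 3) 1 2)

theorem cocycle_apply_self (ξ : X.invDual) :
    X.cocycle ξ ⟨(1, 2), rfl⟩ = X.triForm (0 : Fin 3) 1 2 ξ :=
  totSingle_apply_self (p := 1) (q := 2) rfl (X.triForm 0 1 2 ξ)

theorem cocycle_apply_of_ne (ξ : X.invDual) (e : {e : ℕ × ℕ // e.1 + e.2 = 3})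
    (he : e.1 ≠ (1, 2)) : X.cocycle ξ e = 0 :=
  totSingle_apply_of_ne (p := 1) (q := 2) rfl (X.triForm 0 1 2 ξ) he

theorem totD_cocycle
    (hX : (∀ χ : G →* Multiplicative ℝ, (∀ g ∈ connectedComponent (1 : G), χ g = 1) → χ = 1) ∨
      Function.Surjective (mfderiv 𝓘(ℝ, V) 𝓘(ℝ, W) X.bd 1)) (ξ : X.invDual) :
    X.totD 3 (X.cocycle ξ) = 0 :=
  X.totD_totSingle_eq_zero rfl (X.dForm_triForm 0 1 2 ξ)
    (X.del_triForm (X.pullback_actMap_leftInvariantDForm hX ξ))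

end Cocycle

end LieCrossedModule

end LieTwo

end

theorem mainTheorem6_general {V W G H : Type u}
    [NormedAddCommGroup V] [NormedSpace ℝ V]
    [NormedAddCommGroup W] [NormedSpace ℝ W]
    [TopologicalSpace G] [ChartedSpace V G] [Group G] [LieGroup 𝓘(ℝ, V) ∞ G]
    [TopologicalSpace H] [ChartedSpace W H] [Group H] [LieGroup 𝓘(ℝ, W) ∞ H]
    (X : LieTwo.LieCrossedModule V W G H) :
    ∃ I : X.invDual →ₗ[ℝ] LieTwo.LieCrossedModule.Tot V W G H 3,
      (∀ ξ : X.invDual, (I ξ ⟨(1, 2), rfl⟩).raw =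
        LieTwo.rawPullback (fun x => (X.nerveTwo x).1)
          (LieTwo.LieCrossedModule.leftInvariantForm V G ξ.1)) ∧
      (∀ (ξ : X.invDual) (e : {e : ℕ × ℕ // e.1 + e.2 = 3}), e.1 ≠ (1, 2) → I ξ e = 0) ∧
      (∀ ξ : X.invDual, LieTwo.LieCrossedModule.dForm 1 2 (I ξ ⟨(1, 2), rfl⟩) = 0) ∧
      (((∀ χ : G →* Multiplicative ℝ, (∀ g ∈ connectedComponent (1 : G), χ g = 1) → χ = 1) ∨
          Function.Surjective (mfderiv 𝓘(ℝ, V) 𝓘(ℝ, W) X.bd 1)) →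
        (∀ ξ : X.invDual, X.totD 3 (I ξ) = 0) ∧
        ∃ Φ : (HomologicalComplex.single (ModuleCat.{u} ℝ) (ComplexShape.up ℕ) 3).obj
            (ModuleCat.of ℝ X.invDual) ⟶ X.totComplex,
          ∀ ξ : X.invDual, (Φ.f 3).hom ((HomologicalComplex.singleObjXSelf (ComplexShape.up ℕ) 3
            (ModuleCat.of ℝ X.invDual)).inv.hom ξ) = I ξ) := by
  refine ⟨X.cocycle, fun ξ => ?_, X.cocycle_apply_of_ne, fun ξ => ?_, fun hX => ?_⟩
  · rw [X.cocycle_apply_self]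
    rfl
  · rw [X.cocycle_apply_self, X.dForm_triForm]
  refine ⟨X.totD_cocycle hX, LieTwo.exists_hom_single_of_d_eq_zero (K := X.totComplex) (n := 3)
    (A := ModuleCat.of ℝ X.invDual) (ModuleCat.ofHom X.cocycle) ?_⟩
  rintro _ rfl ξ
  exact (X.totComplex_d_apply 3 _).trans (X.totD_cocycle hX ξ)

theorem mainTheorem6 {V W G H : Type u}
    [NormedAddCommGroup V] [NormedSpace ℝ V] [FiniteDimensional ℝ V]
    [NormedAddCommGroup W] [NormedSpace ℝ W] [FiniteDimensional ℝ W]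
    [TopologicalSpace G] [ChartedSpace V G] [Group G] [LieGroup 𝓘(ℝ, V) ∞ G]
    [TopologicalSpace H] [ChartedSpace W H] [Group H] [LieGroup 𝓘(ℝ, W) ∞ H]
    (X : LieTwo.LieCrossedModule V W G H) :
    ∃ I : X.invDual →ₗ[ℝ] LieTwo.LieCrossedModule.Tot V W G H 3,
      -- `I ξ` lies in `Ω^1(N_2)`, where it is the pullback of `ξ^L` along `G × H × H → G`
      (∀ ξ : X.invDual, (I ξ ⟨(1, 2), rfl⟩).raw =
        LieTwo.rawPullback (fun x => (X.nerveTwo x).1)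
          (LieTwo.LieCrossedModule.leftInvariantForm V G ξ.1)) ∧
      (∀ (ξ : X.invDual) (e : {e : ℕ × ℕ // e.1 + e.2 = 3}), e.1 ≠ (1, 2) → I ξ e = 0) ∧
      -- the de Rham part of the cocycle equation
      (∀ ξ : X.invDual, LieTwo.LieCrossedModule.dForm 1 2 (I ξ ⟨(1, 2), rfl⟩) = 0) ∧
      -- the full cocycle equation
      (((∀ χ : G →* Multiplicative ℝ, (∀ g ∈ connectedComponent (1 : G), χ g = 1) → χ = 1) ∨
          Function.Surjective (mfderiv 𝓘(ℝ, V) 𝓘(ℝ, W) X.bd 1)) →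
        (∀ ξ : X.invDual, X.totD 3 (I ξ) = 0) ∧
        ∃ Φ : (HomologicalComplex.single (ModuleCat.{u} ℝ) (ComplexShape.up ℕ) 3).obj
            (ModuleCat.of ℝ X.invDual) ⟶ X.totComplex,
          ∀ ξ : X.invDual, (Φ.f 3).hom ((HomologicalComplex.singleObjXSelf (ComplexShape.up ℕ) 3
            (ModuleCat.of ℝ X.invDual)).inv.hom ξ) = I ξ) :=
  mainTheorem6_general X
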